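/- **Setting.** Let $f:\mathbb R^n\to\mathbb R$ be $\mu$-strongly convex ($\mu>0$, $f$ not necessarily differentiable), $A\in\mathbb R^{m\times n}$, and consider $\min_{Ax=0}f(x)$ with solution $x^*$. Let $x(u)=\arg\max_x\{\langle u,x\rangle-f(x)\}$ and $\psi(y)=\max_x\{\langle A^\top y,x\rangle-f(x)\}$, let $y^*$ be the minimizer of $\psi$ of least Euclidean norm. Let $M_f=\|\nabla f(x^*)\|_2$, where for non-differentiable $f$ the symbol $\nabla f(x^*)$ stands for any subgradient of $f$ at $x^*$ that is orthogonal to $\operatorname{Ker}A$. Let $\lambda_{\max}$ and $\lambda^+_{\min}$ be the largest and the least positive eigenvalue of $A^\top A$, $\chi=\lambda_{\max}/\lambda_{\min}^+$, $L_\psi=\lambda_{\max}/\mu$, $\tilde L=2L_\psi$. *Oracle.* $\tilde x(u,\xi)$ satisfies, for all $u$, $\|\mathbb E_\xi\tilde x(u,\xi)-x(u)\|_2\le\delta_y$ and $\mathbb E_\xi\exp\left(\|\tilde x(u,\xi)-\mathbb E_\xi\tilde x(u,\xi)\|_2^2/\sigma_x^2\right)\le e$, with $\sigma_x>0$. Put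 $\delta=\sqrt{\lambda_{\max}}\,\delta_y$, $\sigma_\psi=\sqrt{\lambda_{\max}}\,\sigma_x$. *Method (SPDSTM).* $y^0=z^0=0$, $A_0=0$. At iteration $k=0,1,\dots$ let $\alpha_{k+1}>0$ solve $2\tilde L\alpha_{k+1}^2=A_k+\alpha_{k+1}$, let $A_{k+1}=A_k+\alpha_{k+1}$ and $\tilde y^{k+1}=(A_ky^k+\alpha_{k+1}z^k)/A_{k+1}$; draw a fresh i.i.d. batch $\xi^{k,1},\dots,\xi^{k,r_k}$ and compute $X^{k+1}=\frac1{r_k}\sum_{l}\tilde x(A^\top\tilde y^{k+1},\xi^{k,l})$; let $z^{k+1}=z^k-\alpha_{k+1}AX^{k+1}$, $y^{k+1}=(A_ky^k+\alpha_{k+1}z^{k+1})/A_{k+1}$. The output is $y^N$ and $\tilde x^N=\frac1{A_N}\sum_{k=1}^N\alpha_kX^k$. **Theorem.** There are absolute constants $H,K,C_1>0$ and, for every $\Lambda>0$, constants $G,\hat C,C_2>0$ depending only on $\Lambda$, such that the following holds for all data as above. One has $\|y^*\|_2\le M_f/\sqrt{\lambda^+_{\min}}$. Let $R_y>0$ satisfy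 $\|y^*\|_2\le R_y\le M_f/\sqrt{\lambda_{\min}^+}$, let $0<\varepsilon\le H\tilde LR_y^2$ and $\beta\in(0,\frac18)$. Then there are integers $N\ge1$ with $$\frac{H\tilde LR_y^2}{4N^2}\le\varepsilon\le\frac{H\tilde LR_y^2}{N^2},$$ and for every such $N$: 1. $N\le C_1\sqrt{\frac{M_f^2}{\mu\varepsilon}\chi}$. 2. For the batch sizes $r_k=\left\lceil\max\left\{1,\frac{\sigma_\psi^2\tilde\alpha_k\ln(N/\beta)}{\hat C\varepsilon}\right\}\right\rceil$, where $\tilde\alpha_k=\frac{k+1}{2\tilde L}$, the total number of oracle calls satisfies $$\sum_{k=0}^Nr_k\le C_2\max\left\{\frac{\sigma_x^2M_f^2}{\varepsilon^2}\chi\,\ln\left(\frac{C_1}{\beta}\sqrt{\frac{M_f^2}{\mu\varepsilon}\chi}\right),\ \sqrt{\frac{M_f^2}{\mu\varepsilon}\chi}\right\}.$$ 3. Suppose that $f$ is $L_f$-Lipschitz on the ball $B_{R_f}(0)$, where $R_f\ge K\max\left\{\frac{R_y}{A_N\sqrt{\lambda_{\max}}},\frac{\sqrt{\lambda_{\max}}R_y}{\mu},\|x(A^\top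 y^*)\|_2\right\}$ and $L_f\le\Lambda\sqrt{\lambda_{\max}}R_y$, that $\delta\le\frac{G\tilde LR_y}{(N+1)^2}$, and that $r_k\ge\max\left\{1,\frac{\sigma_\psi^2\tilde\alpha_k\ln(N/\beta)}{\hat C\varepsilon}\right\}$ for all $k<N$. Then with probability at least $1-4\beta$ $$f(\tilde x^N)-f(x^*)\le f(\tilde x^N)+\psi(y^N)\le\varepsilon,\qquad\|A\tilde x^N\|_2\le\frac{\varepsilon}{R_y}.$$ -/

import Mathlib

open MeasureTheory ProbabilityTheory

/-- The space `ℝⁿ` with the Euclidean norm. -/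
abbrev Vec (n : ℕ) : Type := EuclideanSpace ℝ (Fin n)

noncomputable section SPDSTM

/-- Transpose of the matrix of a linear map `ℝⁿ → ℝᵐ`. -/
abbrev tr {n m : ℕ} (A : Vec n →L[ℝ] Vec m) : Vec m →L[ℝ] Vec n :=
  ContinuousLinearMap.adjoint A

/-- The eigenvalues of `AᵀA`. -/
def gramEigenvalues {n m : ℕ} (A : Vec n →L[ℝ] Vec m) : Set ℝ :=
  {t | Module.End.HasEigenvalue ((tr A ∘L A : Vec n →L[ℝ] Vec n) : Vec n →ₗ[ℝ] Vec n) t}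

/-- `λ_max(AᵀA)`. -/
def lamMax {n m : ℕ} (A : Vec n →L[ℝ] Vec m) : ℝ := sSup (gramEigenvalues A)

/-- `λ⁺_min(AᵀA)`, the least positive eigenvalue of `AᵀA`. -/
def lamMinPos {n m : ℕ} (A : Vec n →L[ℝ] Vec m) : ℝ := sInf {t ∈ gramEigenvalues A | 0 < t}

/-- `χ(AᵀA) = λ_max(AᵀA) / λ⁺_min(AᵀA)`. -/
def chi {n m : ℕ} (A : Vec n →L[ℝ] Vec m) : ℝ := lamMax A / lamMinPos A

/-- `g` is a subgradient of `f` at `x`. -/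
def IsSubgradientAt {n : ℕ} (f : Vec n → ℝ) (g x : Vec n) : Prop :=
  ∀ x', f x + inner ℝ g (x' - x) ≤ f x'

/-- `φ(u) = max_x {⟨u, x⟩ - f(x)}`. For strongly convex `f` the supremum is attained. -/
def dualPhi {n : ℕ} (f : Vec n → ℝ) (u : Vec n) : ℝ := ⨆ x, (inner ℝ u x - f x)

/-- `ψ(y) = φ(Aᵀy)`. -/
def dualPsi {n m : ℕ} (f : Vec n → ℝ) (A : Vec n →L[ℝ] Vec m) (y : Vec m) : ℝ :=
  dualPhi f (tr A y)

/-- `x(u) = argmax_x {⟨u, x⟩ - f(x)}`. For strongly convex `f` the maximizer exists and is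
unique. -/
def argDual {n : ℕ} (f : Vec n → ℝ) (u : Vec n) : Vec n :=
  Classical.epsilon fun x => IsMaxOn (fun x' => inner ℝ u x' - f x') Set.univ x

/-- `xt u s` (with `s` distributed according to `ν`) is a stochastic oracle for `x(u)` with bias
at most `δy` and light tails with parameter `σx`, at every point `u`. -/
structure IsBiasedOracle {n : ℕ} {S : Type*} [MeasurableSpace S] (f : Vec n → ℝ) (ν : Measure S)
    (xt : Vec n → S → Vec n) (δy σx : ℝ) : Prop where
  measurable : Measurable (Function.uncurry xt)
  integrable : ∀ u, Integrable (xt u) ν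
  bias : ∀ u, ‖(∫ s, xt u s ∂ν) - argDual f u‖ ≤ δy
  lightTails : ∀ u,
    ∫⁻ s, ENNReal.ofReal (Real.exp (‖xt u s - ∫ s', xt u s' ∂ν‖ ^ 2 / σx ^ 2)) ∂ν
      ≤ ENNReal.ofReal (Real.exp 1)

/-- The batched oracle `(1/r) ∑_{l < r} x̃(u, s_l)`. -/
def batchX {n : ℕ} {S : Type*} (xt : Vec n → S → Vec n) (r : ℕ) (s : ℕ → S) (u : Vec n) : Vec n :=
  (r : ℝ)⁻¹ • ∑ l ∈ Finset.range r, xt u (s l)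

/-- The batched stochastic gradient `(1/r) ∑_{l < r} A x̃(Aᵀy, s_l)` of `ψ` at `y`. -/
def batchGrad {n m : ℕ} {S : Type*} (A : Vec n →L[ℝ] Vec m) (xt : Vec n → S → Vec n) (r : ℕ)
    (s : ℕ → S) (y : Vec m) : Vec m :=
  A (batchX xt r s (tr A y))

/-- The positive solution `α` of `2 L α² = a + α`. -/
def nextStep (L a : ℝ) : ℝ := (1 + √(1 + 8 * L * a)) / (4 * L)

theorem nextStep_pos {L a : ℝ} (hL : 0 < L) : 0 < nextStep L a := by
  unfold nextStep; positivity

theorem nextStep_eq {L a : ℝ} (hL : 0 < L) (ha : 0 ≤ a) :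
    2 * L * nextStep L a ^ 2 = a + nextStep L a := by
  have h : √(1 + 8 * L * a) ^ 2 = 1 + 8 * L * a := Real.sq_sqrt (by positivity)
  unfold nextStep
  generalize √(1 + 8 * L * a) = q at h
  field_simp
  linear_combination 2 * h

/-- `A_k`: `A_0 = 0` and `A_{k+1} = A_k + α_{k+1}`, where `2 L α_{k+1}² = A_k + α_{k+1}`. -/
def accA (L : ℝ) : ℕ → ℝ
  | 0 => 0
  | k + 1 => accA L k + nextStep L (accA L k)

/-- `α_{k+1}`. -/
def stepSucc (L : ℝ) (k : ℕ) : ℝ := nextStep L (accA L k)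

/-- `ỹ^{k+1} = (A_k y^k + α_{k+1} z^k) / A_{k+1}`, as a function of the pair `(y^k, z^k)`. -/
def midPoint {m : ℕ} (L : ℝ) (k : ℕ) (w : Vec m × Vec m) : Vec m :=
  (accA L (k + 1))⁻¹ • (accA L k • w.1 + stepSucc L k • w.2)

/-- The pairs `(y^k, z^k)` of SPDSTM with parameter `L`, where `grad k` is the batched stochastic
gradient of iteration `k`:
`z^{k+1} = z^k - α_{k+1} grad_k(ỹ^{k+1})`, `y^{k+1} = (A_k y^k + α_{k+1} z^{k+1}) / A_{k+1}`. -/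
def spdstmState {m : ℕ} (L : ℝ) (grad : ℕ → Vec m → Vec m) : ℕ → Vec m × Vec m
  | 0 => (0, 0)
  | k + 1 =>
    let w := spdstmState L grad k
    let z' := w.2 - stepSucc L k • grad k (midPoint L k w)
    ((accA L (k + 1))⁻¹ • (accA L k • w.1 + stepSucc L k • z'), z')

/-- The output `y^N` of SPDSTM; `r k` is the size of the batch of iteration `k` and
`s k l` are its samples. -/
def spdstmY {n m : ℕ} {S : Type*} (L : ℝ) (A : Vec n →L[ℝ] Vec m) (xt : Vec n → S → Vec n)
    (r : ℕ → ℕ) (s : ℕ → ℕ → S) (N : ℕ) : Vec m :=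
  (spdstmState L (fun k => batchGrad A xt (r k) (s k)) N).1

/-- The query point `ỹ^{k+1}` of iteration `k` of SPDSTM. -/
def spdstmQuery {n m : ℕ} {S : Type*} (L : ℝ) (A : Vec n →L[ℝ] Vec m) (xt : Vec n → S → Vec n)
    (r : ℕ → ℕ) (s : ℕ → ℕ → S) (k : ℕ) : Vec m :=
  midPoint L k (spdstmState L (fun k => batchGrad A xt (r k) (s k)) k)

/-- The output `x̃^N = (1/A_N) ∑_{k=1}^N α_k x̃(Aᵀỹ^k)` of SPDSTM (the term `k = 0` has weight
`α_0 = 0`), where the batch at `ỹ^k` is the one that the algorithm has drawn there. -/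
def spdstmX {n m : ℕ} {S : Type*} (L : ℝ) (A : Vec n →L[ℝ] Vec m) (xt : Vec n → S → Vec n)
    (r : ℕ → ℕ) (s : ℕ → ℕ → S) (N : ℕ) : Vec n :=
  (accA L N)⁻¹ • ∑ k ∈ Finset.range N,
    stepSucc L k • batchX xt (r k) (s k) (tr A (spdstmQuery L A xt r s k))

/-- `L̃ = 2 L_ψ = 2 λ_max(AᵀA) / μ`. -/
def Ltilde {n m : ℕ} (A : Vec n →L[ℝ] Vec m) (μ : ℝ) : ℝ := 2 * (lamMax A / μ)

/-- `max {1, σ_ψ² α̃_k ln(N/β) / (Ĉ ε)}` with `σ_ψ² = λ_max(AᵀA) σ_x²` and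
`α̃_k = (k+1) / (2 L̃)`. -/
def batchBound {n m : ℕ} (A : Vec n →L[ℝ] Vec m) (μ σx ε β Chat : ℝ) (N k : ℕ) : ℝ :=
  max 1 (lamMax A * σx ^ 2 * ((k + 1) / (2 * Ltilde A μ)) * Real.log (N / β) / (Chat * ε))

end SPDSTM

/-! The gradient of `ψ` at `q` is `A x(Aᵀq)`, and by strong convexity it is Lipschitz with constant
`λ_max/μ`. Let `e_k` be the error of the batched oracle at step `k` and `E_k = ∑_{j<k} α_{j+1} e_j`.
One similar-triangles step, compared with an arbitrary point `u`, costs only `α⟨A e_k, u - z^k⟩ +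
α²‖A e_k‖²`, because `L̃` is twice the smoothness constant (`similar_triangles_step`).

Telescoping is done for two choices of `u`. Taking `u = y^*` bounds `‖z^k - y^*‖²/2` by a quantity
`D_k` depending on the errors (`half_sq_norm_sub_le_distBound`). Taking `u = 0` turns the linear
model of `ψ` into `-f(x_k)`, with `x_k` the exact maximizer, and bounds `A_N ψ(y^N) + ∑ α_{k+1}
f(x_k)` by `D_N` and `E_N` (`accA_mul_dualPsi_add_sum_le`). Feasibility comes for free, since `A
x̃^N = -z^N / A_N`. The output differs from the weighted mean of the `x_k` by `E_N / A_N`, which the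
Lipschitz bound on `f` pays for.

It remains to bound `D_k` and `E_k` with high probability. Both sit in one potential `Φ_k = D_k + τ
λ ‖E_k‖²`, whose increment is linear plus quadratic in `e_k`. The linear coefficient `w_k` satisfies
`‖w_k‖² ≤ 8τλ Φ_k` (`sq_norm_errorDirection_le`), so the noise is controlled by the potential itself
and no a priori bound on the iterates is needed. Conditionally on the past, averaging a batch is
subgaussian with a dimension-free parameter `σ²/r` (`lintegral_exp_inner_average_le`). Hence `E
exp(θ(Φ_{k+1} + R²)) ≤ E exp(θ(1+ρ_k)(Φ_k + R²))`; the batch sizes and the bias bound make `∑ ρ_k ≤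
1/2`, so iteration, Markov's inequality and a union bound give `Φ_k < 3R²` for all `k ≤ N` with
probability at least `1 - β`.

The bound on `‖y^*‖` holds because a subgradient orthogonal to `Ker A` has the form `AᵀA v`, and `A
v` is then a dual minimizer. -/

/-! ### Exponential moments of light-tailed vectors and of their averages. -/

noncomputable section Subgaussian

theorem exp_le_add_exp_sq (x : ℝ) : Real.exp x ≤ x + Real.exp (x ^ 2) := by
  have h2 := Real.add_one_le_exp (x ^ 2)
  rcases le_or_gt x 1 with h | h
  · rcases le_or_gt (-1) x with h' | h'
    · have := (abs_le.1 (Real.abs_exp_sub_one_sub_id_le (abs_le.2 ⟨h', h⟩))).2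
      linarith
    · have : Real.exp x ≤ 1 := Real.exp_le_one_iff.2 (by linarith)
      nlinarith
  · have : Real.exp x ≤ Real.exp (x ^ 2) := Real.exp_le_exp.2 (by nlinarith)
    linarith

/-- Convexity of `exp` between `0` and `w - 1`. The bound is affine in `exp w` and becomes exactly
`exp t` when `exp w` is replaced by `e`, so integrating it stands in for Jensen's inequality and
asks no measurability of `W`. -/
theorem exp_mul_le_affine {t : ℝ} (ht0 : 0 ≤ t) (ht1 : t ≤ 1) (w : ℝ) :
    Real.exp (t * w) ≤ Real.exp t * (1 - t) + Real.exp t * t * Real.exp (-1) * Real.exp w := by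
  have h := convexOn_exp.2 (Set.mem_univ (w - 1)) (Set.mem_univ 0) ht0
    (sub_nonneg.2 ht1) (by ring)
  simp only [smul_eq_mul, mul_zero, add_zero, Real.exp_zero, mul_one] at h
  have e1 : Real.exp (t * w) = Real.exp t * Real.exp (t * (w - 1)) := by
    rw [← Real.exp_add]; congr 1; ring
  have e2 : Real.exp (w - 1) = Real.exp (-1) * Real.exp w := by
    rw [← Real.exp_add]; congr 1; ring
  rw [e1]
  rw [e2] at h
  have := mul_le_mul_of_nonneg_left h (Real.exp_pos t).le
  linarith

/-- If `E exp W ≤ e`, then `E exp (tW) ≤ exp t` for `0 ≤ t ≤ 1`. -/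
theorem lintegral_exp_mul_le {Ω : Type*} [MeasurableSpace Ω] {P : Measure Ω}
    [IsProbabilityMeasure P] {W : Ω → ℝ}
    (h : ∫⁻ ω, ENNReal.ofReal (Real.exp (W ω)) ∂P ≤ ENNReal.ofReal (Real.exp 1))
    {t : ℝ} (ht0 : 0 ≤ t) (ht1 : t ≤ 1) :
    ∫⁻ ω, ENNReal.ofReal (Real.exp (t * W ω)) ∂P ≤ ENNReal.ofReal (Real.exp t) := by
  have h1 : 0 ≤ Real.exp t * (1 - t) := mul_nonneg (Real.exp_pos t).le (sub_nonneg.2 ht1)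
  have h2 : 0 ≤ Real.exp t * t * Real.exp (-1) := by positivity
  calc ∫⁻ ω, ENNReal.ofReal (Real.exp (t * W ω)) ∂P
      ≤ ∫⁻ ω, (ENNReal.ofReal (Real.exp t * (1 - t)) +
          ENNReal.ofReal (Real.exp t * t * Real.exp (-1)) *
            ENNReal.ofReal (Real.exp (W ω))) ∂P := by
        refine lintegral_mono fun ω => ?_
        rw [← ENNReal.ofReal_mul h2, ← ENNReal.ofReal_add h1 (by positivity)]
        exact ENNReal.ofReal_le_ofReal (exp_mul_le_affine ht0 ht1 _)
    _ = ENNReal.ofReal (Real.exp t * (1 - t)) +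
          ENNReal.ofReal (Real.exp t * t * Real.exp (-1)) *
            ∫⁻ ω, ENNReal.ofReal (Real.exp (W ω)) ∂P := by
        rw [lintegral_add_left measurable_const,
          lintegral_const_mul' _ _ ENNReal.ofReal_ne_top]
        simp
    _ ≤ ENNReal.ofReal (Real.exp t * (1 - t)) +
          ENNReal.ofReal (Real.exp t * t * Real.exp (-1)) * ENNReal.ofReal (Real.exp 1) := by
        gcongr
    _ = ENNReal.ofReal (Real.exp t) := by
        rw [← ENNReal.ofReal_mul h2, ← ENNReal.ofReal_add h1 (by positivity)]
        congr 1
        have : Real.exp (-1) * Real.exp 1 = 1 := by rw [← Real.exp_add]; simp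
        linear_combination Real.exp t * t * this

variable {Ω E : Type*} [MeasurableSpace Ω] [NormedAddCommGroup E] [InnerProductSpace ℝ E]
  [MeasurableSpace E]

/-- A centered random vector with `E exp (‖Z‖² / σ²) ≤ e`. -/
structure IsLightTailed (P : Measure Ω) (Z : Ω → E) (σ : ℝ) : Prop where
  measurable : Measurable Z
  integrable : Integrable Z P
  mean : ∫ ω, Z ω ∂P = 0
  tail : ∫⁻ ω, ENNReal.ofReal (Real.exp (‖Z ω‖ ^ 2 / σ ^ 2)) ∂P ≤ ENNReal.ofReal (Real.exp 1)

variable {P : Measure Ω} [IsProbabilityMeasure P] {Z : Ω → E} {σ : ℝ}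

theorem IsLightTailed.lintegral_exp_sq_le (hZ : IsLightTailed P Z σ) (hσ : 0 < σ) {c : ℝ}
    (hc : 0 ≤ c) (hc1 : c * σ ^ 2 ≤ 1) :
    ∫⁻ ω, ENNReal.ofReal (Real.exp (c * ‖Z ω‖ ^ 2)) ∂P ≤
      ENNReal.ofReal (Real.exp (c * σ ^ 2)) := by
  have e : ∀ ω, c * ‖Z ω‖ ^ 2 = c * σ ^ 2 * (‖Z ω‖ ^ 2 / σ ^ 2) := fun ω => by field_simp
  simp_rw [e]
  exact lintegral_exp_mul_le hZ.tail (by positivity) hc1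

variable [CompleteSpace E] [BorelSpace E]

theorem IsLightTailed.lintegral_exp_inner_le (hZ : IsLightTailed P Z σ) (hσ : 0 < σ) (u : E) :
    ∫⁻ ω, ENNReal.ofReal (Real.exp (inner ℝ u (Z ω))) ∂P ≤
      ENNReal.ofReal (Real.exp (σ ^ 2 * ‖u‖ ^ 2)) := by
  -- For small `u`, `exp x ≤ x + exp (x²)` applies and the linear term has mean zero. For large `u`,
  -- Young's inequality leaves a factor `exp (1/2)`, absorbed because `σ²‖u‖² > 1`.
  rcases le_or_gt (‖u‖ ^ 2 * σ ^ 2) 1 with h | h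
  · have h1 := hZ.lintegral_exp_sq_le hσ (by positivity) h
    have hm : Measurable fun ω => Real.exp (‖u‖ ^ 2 * ‖Z ω‖ ^ 2) := by
      have := hZ.measurable
      fun_prop
    have hi : Integrable (fun ω => Real.exp (‖u‖ ^ 2 * ‖Z ω‖ ^ 2)) P := by
      refine ⟨hm.aestronglyMeasurable, ?_⟩
      rw [hasFiniteIntegral_iff_ofReal (Filter.Eventually.of_forall fun ω => (Real.exp_pos _).le)]
      exact h1.trans_lt ENNReal.ofReal_lt_top
    have hl : Integrable (fun ω => inner ℝ u (Z ω)) P := hZ.integrable.const_inner u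
    have h2 : ∫ ω, (inner ℝ u (Z ω) + Real.exp (‖u‖ ^ 2 * ‖Z ω‖ ^ 2)) ∂P
        = ∫ ω, Real.exp (‖u‖ ^ 2 * ‖Z ω‖ ^ 2) ∂P := by
      rw [integral_add hl hi, integral_inner hZ.integrable, hZ.mean]; simp
    have key : ∀ ω, Real.exp (inner ℝ u (Z ω)) ≤
        inner ℝ u (Z ω) + Real.exp (‖u‖ ^ 2 * ‖Z ω‖ ^ 2) := fun ω => by
      refine (exp_le_add_exp_sq _).trans ?_
      gcongr
      rw [← mul_pow, ← sq_abs]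
      exact pow_le_pow_left₀ (abs_nonneg _) (abs_real_inner_le_norm _ _) 2
    calc ∫⁻ ω, ENNReal.ofReal (Real.exp (inner ℝ u (Z ω))) ∂P
        ≤ ∫⁻ ω, ENNReal.ofReal (inner ℝ u (Z ω) + Real.exp (‖u‖ ^ 2 * ‖Z ω‖ ^ 2)) ∂P :=
          lintegral_mono fun ω => ENNReal.ofReal_le_ofReal (key ω)
      _ = ENNReal.ofReal (∫ ω, (inner ℝ u (Z ω) + Real.exp (‖u‖ ^ 2 * ‖Z ω‖ ^ 2)) ∂P) :=
          (ofReal_integral_eq_lintegral_ofReal (hl.add hi) (Filter.Eventually.of_forall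
            fun ω => (Real.exp_pos _).le.trans (key ω))).symm
      _ = ∫⁻ ω, ENNReal.ofReal (Real.exp (‖u‖ ^ 2 * ‖Z ω‖ ^ 2)) ∂P := by
          rw [h2]
          exact ofReal_integral_eq_lintegral_ofReal hi (Filter.Eventually.of_forall
            fun ω => (Real.exp_pos _).le)
      _ ≤ _ := by rw [mul_comm (σ ^ 2)]; exact h1
  · have h1 := hZ.lintegral_exp_sq_le hσ (c := (2 * σ ^ 2)⁻¹) (by positivity)
      (by field_simp; norm_num)
    have key : ∀ ω, Real.exp (inner ℝ u (Z ω)) ≤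
        Real.exp (σ ^ 2 * ‖u‖ ^ 2 / 2) * Real.exp ((2 * σ ^ 2)⁻¹ * ‖Z ω‖ ^ 2) := fun ω => by
      rw [← Real.exp_add]
      refine Real.exp_le_exp.2 ((real_inner_le_norm _ _).trans ?_)
      have h3 : 0 ≤ (σ * ‖u‖ - ‖Z ω‖ / σ) ^ 2 := sq_nonneg _
      have h4 : (σ * ‖u‖ - ‖Z ω‖ / σ) ^ 2 =
        2 * (σ ^ 2 * ‖u‖ ^ 2 / 2 + (2 * σ ^ 2)⁻¹ * ‖Z ω‖ ^ 2 - ‖u‖ * ‖Z ω‖) := by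
        field_simp; ring
      linarith
    calc ∫⁻ ω, ENNReal.ofReal (Real.exp (inner ℝ u (Z ω))) ∂P
        ≤ ∫⁻ ω, ENNReal.ofReal (Real.exp (σ ^ 2 * ‖u‖ ^ 2 / 2)) *
            ENNReal.ofReal (Real.exp ((2 * σ ^ 2)⁻¹ * ‖Z ω‖ ^ 2)) ∂P :=
          lintegral_mono fun ω => by
            rw [← ENNReal.ofReal_mul (Real.exp_pos _).le]
            exact ENNReal.ofReal_le_ofReal (key ω)
      _ = ENNReal.ofReal (Real.exp (σ ^ 2 * ‖u‖ ^ 2 / 2)) *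
            ∫⁻ ω, ENNReal.ofReal (Real.exp ((2 * σ ^ 2)⁻¹ * ‖Z ω‖ ^ 2)) ∂P :=
          lintegral_const_mul' _ _ ENNReal.ofReal_ne_top
      _ ≤ ENNReal.ofReal (Real.exp (σ ^ 2 * ‖u‖ ^ 2 / 2)) *
            ENNReal.ofReal (Real.exp ((2 * σ ^ 2)⁻¹ * σ ^ 2)) := by gcongr
      _ ≤ _ := by
          rw [← ENNReal.ofReal_mul (Real.exp_pos _).le, ← Real.exp_add]
          refine ENNReal.ofReal_le_ofReal (Real.exp_le_exp.2 ?_)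
          have : (2 * σ ^ 2)⁻¹ * σ ^ 2 = 1 / 2 := by field_simp
          rw [this]; linarith

theorem IsLightTailed.lintegral_exp_inner_add_sq_le (hZ : IsLightTailed P Z σ) (hσ : 0 < σ)
    (v : E) {c : ℝ} (hc : 0 ≤ c) (hc1 : 2 * c * σ ^ 2 ≤ 1) :
    ∫⁻ ω, ENNReal.ofReal (Real.exp (inner ℝ v (Z ω) + c * ‖Z ω‖ ^ 2)) ∂P ≤
      ENNReal.ofReal (Real.exp (2 * σ ^ 2 * ‖v‖ ^ 2 + c * σ ^ 2)) := by
  -- The two factors are decoupled by `2pq ≤ p² + q²`, with weights `exp (∓a/2)` chosen so that both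
  -- halves receive the same bound.
  set a : ℝ := 2 * σ ^ 2 * ‖v‖ ^ 2 - c * σ ^ 2 with ha
  have h1 := hZ.lintegral_exp_inner_le hσ ((2 : ℝ) • v)
  have h2 := hZ.lintegral_exp_sq_le hσ (c := 2 * c) (by positivity) hc1
  have key : ∀ ω, Real.exp (inner ℝ v (Z ω) + c * ‖Z ω‖ ^ 2) ≤
      Real.exp (-a) / 2 * Real.exp (inner ℝ ((2 : ℝ) • v) (Z ω)) +
        Real.exp a / 2 * Real.exp (2 * c * ‖Z ω‖ ^ 2) := fun ω => by
    have h3 := two_mul_le_add_sq (Real.exp (-(a / 2) + inner ℝ v (Z ω)))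
      (Real.exp (a / 2 + c * ‖Z ω‖ ^ 2))
    rw [mul_assoc, ← Real.exp_add, ← Real.exp_nat_mul, ← Real.exp_nat_mul] at h3
    have e1 : ((2 : ℕ) : ℝ) * (-(a / 2) + inner ℝ v (Z ω)) =
      -a + inner ℝ ((2 : ℝ) • v) (Z ω) := by rw [real_inner_smul_left]; push_cast; ring
    have e2 : ((2 : ℕ) : ℝ) * (a / 2 + c * ‖Z ω‖ ^ 2) = a + 2 * c * ‖Z ω‖ ^ 2 := by
      push_cast; ring
    have e3 : -(a / 2) + inner ℝ v (Z ω) + (a / 2 + c * ‖Z ω‖ ^ 2) =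
      inner ℝ v (Z ω) + c * ‖Z ω‖ ^ 2 := by ring
    rw [e1, e2, e3, Real.exp_add (-a), Real.exp_add a] at h3
    linarith
  have hm : Measurable fun ω => ENNReal.ofReal (Real.exp (-a) / 2) *
      ENNReal.ofReal (Real.exp (inner ℝ ((2 : ℝ) • v) (Z ω))) := by
    have := hZ.measurable
    fun_prop
  calc ∫⁻ ω, ENNReal.ofReal (Real.exp (inner ℝ v (Z ω) + c * ‖Z ω‖ ^ 2)) ∂P
      ≤ ∫⁻ ω, (ENNReal.ofReal (Real.exp (-a) / 2) *
            ENNReal.ofReal (Real.exp (inner ℝ ((2 : ℝ) • v) (Z ω))) +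
          ENNReal.ofReal (Real.exp a / 2) *
            ENNReal.ofReal (Real.exp (2 * c * ‖Z ω‖ ^ 2))) ∂P := by
        refine lintegral_mono fun ω => ?_
        rw [← ENNReal.ofReal_mul (by positivity), ← ENNReal.ofReal_mul (by positivity),
          ← ENNReal.ofReal_add (by positivity) (by positivity)]
        exact ENNReal.ofReal_le_ofReal (key ω)
    _ = ENNReal.ofReal (Real.exp (-a) / 2) *
            ∫⁻ ω, ENNReal.ofReal (Real.exp (inner ℝ ((2 : ℝ) • v) (Z ω))) ∂P +
          ENNReal.ofReal (Real.exp a / 2) *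
            ∫⁻ ω, ENNReal.ofReal (Real.exp (2 * c * ‖Z ω‖ ^ 2)) ∂P := by
        rw [lintegral_add_left hm, lintegral_const_mul' _ _ ENNReal.ofReal_ne_top,
          lintegral_const_mul' _ _ ENNReal.ofReal_ne_top]
    _ ≤ ENNReal.ofReal (Real.exp (-a) / 2) *
            ENNReal.ofReal (Real.exp (σ ^ 2 * ‖(2 : ℝ) • v‖ ^ 2)) +
          ENNReal.ofReal (Real.exp a / 2) * ENNReal.ofReal (Real.exp (2 * c * σ ^ 2)) := by
        gcongr
    _ = _ := by
        rw [← ENNReal.ofReal_mul (by positivity), ← ENNReal.ofReal_mul (by positivity),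
          ← ENNReal.ofReal_add (by positivity) (by positivity)]
        congr 1
        rw [div_mul_eq_mul_div, div_mul_eq_mul_div, ← Real.exp_add, ← Real.exp_add]
        have e1 : -a + σ ^ 2 * ‖(2 : ℝ) • v‖ ^ 2 = 2 * σ ^ 2 * ‖v‖ ^ 2 + c * σ ^ 2 := by
          rw [norm_smul, ha, Real.norm_eq_abs, abs_two]; ring
        have e2 : a + 2 * c * σ ^ 2 = 2 * σ ^ 2 * ‖v‖ ^ 2 + c * σ ^ 2 := by rw [ha]; ring
        rw [e1, e2]; ring

theorem IsLightTailed.lintegral_exp_sq_add_le (hZ : IsLightTailed P Z σ) (hσ : 0 < σ)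
    (x : E) {c : ℝ} (hc : 0 ≤ c) (hc1 : 2 * c * σ ^ 2 ≤ 1) :
    ∫⁻ ω, ENNReal.ofReal (Real.exp (c * ‖x + Z ω‖ ^ 2)) ∂P ≤
      ENNReal.ofReal (Real.exp (c * (1 + 8 * c * σ ^ 2) * ‖x‖ ^ 2 + c * σ ^ 2)) := by
  have h := hZ.lintegral_exp_inner_add_sq_le hσ ((2 * c) • x) hc hc1
  have e : ∀ ω, Real.exp (c * ‖x + Z ω‖ ^ 2) = Real.exp (c * ‖x‖ ^ 2) *
      Real.exp (inner ℝ ((2 * c) • x) (Z ω) + c * ‖Z ω‖ ^ 2) := fun ω => by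
    rw [← Real.exp_add, norm_add_sq_real, real_inner_smul_left]; congr 1; ring
  simp_rw [e, ENNReal.ofReal_mul (Real.exp_pos _).le]
  rw [lintegral_const_mul' _ _ ENNReal.ofReal_ne_top]
  refine (mul_le_mul_right h _).trans ?_
  rw [← ENNReal.ofReal_mul (Real.exp_pos _).le, ← Real.exp_add]
  refine ENNReal.ofReal_le_ofReal (Real.exp_le_exp.2 (le_of_eq ?_))
  rw [norm_smul, Real.norm_eq_abs, mul_pow, sq_abs]; ring

/-- Freezing: the joint law is a product, so by Tonelli `Y` may be integrated out with `X` held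
fixed. This takes the place of conditional expectations throughout. -/
theorem lintegral_comp_prodMk_eq_of_indepFun {Ω β γ : Type*} [MeasurableSpace Ω]
    [MeasurableSpace β] [MeasurableSpace γ] {P : Measure Ω} [IsProbabilityMeasure P]
    {X : Ω → β} {Y : Ω → γ} (h : IndepFun X Y P) (hX : Measurable X) (hY : Measurable Y)
    {g : β × γ → ENNReal} (hg : Measurable g) :
    ∫⁻ ω, g (X ω, Y ω) ∂P = ∫⁻ ω, ∫⁻ ω', g (X ω, Y ω') ∂P ∂P := by
  have h1 := (indepFun_iff_map_prod_eq_prod_map_map hX.aemeasurable hY.aemeasurable).1 h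
  have := Measure.isProbabilityMeasure_map (μ := P) hX.aemeasurable
  have := Measure.isProbabilityMeasure_map (μ := P) hY.aemeasurable
  rw [← lintegral_map (f := g) (g := fun ω => (X ω, Y ω)) hg (hX.prodMk hY), h1,
    lintegral_prod _ hg.aemeasurable, lintegral_map (Measurable.lintegral_prod_right' hg) hX]
  refine lintegral_congr fun ω => ?_
  exact lintegral_map (hg.comp measurable_prodMk_left) hY

variable [SecondCountableTopology E]

/-- The last summand is integrated out with the partial sum frozen, which only raises the
coefficient `c` of the squared norm. Dominating the new coefficient by `c/(1 - 8cσ²)` makes `1/c`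
drop by exactly `8σ²` per summand, so the recursion solves in closed form. -/
theorem lintegral_exp_sq_add_sum_le {Z : ℕ → Ω → E} (hZ : ∀ i, IsLightTailed P (Z i) σ)
    (hind : iIndepFun Z P) (hσ : 0 < σ) (x : E) (r : ℕ) {c : ℝ} (hc : 0 ≤ c)
    (hc1 : 8 * c * r * σ ^ 2 < 1) :
    ∫⁻ ω, ENNReal.ofReal (Real.exp (c * ‖x + ∑ i ∈ Finset.range r, Z i ω‖ ^ 2)) ∂P ≤
      ENNReal.ofReal (Real.exp ((c * ‖x‖ ^ 2 + c * r * σ ^ 2) / (1 - 8 * c * r * σ ^ 2))) := by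
  induction r generalizing c with
  | zero => simp
  | succ r ih =>
    push_cast at hc1 ⊢
    have hσ2 : 0 < σ ^ 2 := by positivity
    have hr : 0 ≤ c * r * σ ^ 2 := by positivity
    have hcσ : 0 ≤ c * σ ^ 2 := by positivity
    have h8 : 0 < 1 - 8 * c * σ ^ 2 := by nlinarith
    have h9 : 0 < 1 - 8 * c * (r + 1) * σ ^ 2 := by linarith
    set c' : ℝ := c / (1 - 8 * c * σ ^ 2) with hc'
    have hc'0 : 0 ≤ c' := by positivity
    have hle : c * (1 + 8 * c * σ ^ 2) ≤ c' := by
      rw [hc', le_div_iff₀ h8]; nlinarith [mul_nonneg hc (mul_nonneg hcσ hcσ)]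
    have hc'1 : 1 - 8 * c' * r * σ ^ 2 = (1 - 8 * c * (r + 1) * σ ^ 2) / (1 - 8 * c * σ ^ 2) := by
      rw [hc', eq_div_iff h8.ne']
      field_simp; ring
    have hpos : 0 < 1 - 8 * c' * r * σ ^ 2 := by rw [hc'1]; positivity
    have hT : Measurable (∑ i ∈ Finset.range r, Z i) := by
      have := fun i => (hZ i).measurable
      fun_prop
    have hdec := lintegral_comp_prodMk_eq_of_indepFun
      (g := fun p : E × E => ENNReal.ofReal (Real.exp (c * ‖x + (p.1 + p.2)‖ ^ 2)))
      (hind.indepFun_finsetSum_of_notMem (fun i => (hZ i).measurable)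
        (s := Finset.range r) (i := r) (by simp)) hT (hZ r).measurable (by fun_prop)
    simp only [Finset.sum_apply] at hdec
    simp_rw [Finset.sum_range_succ]
    rw [hdec]
    calc _ ≤ ∫⁻ ω, ENNReal.ofReal (Real.exp (c * σ ^ 2)) * ENNReal.ofReal (Real.exp
            (c' * ‖x + ∑ i ∈ Finset.range r, Z i ω‖ ^ 2)) ∂P := by
          refine lintegral_mono fun ω => ?_
          simp_rw [← add_assoc]
          refine ((hZ r).lintegral_exp_sq_add_le hσ _ hc (by nlinarith)).trans ?_
          rw [← ENNReal.ofReal_mul (Real.exp_pos _).le, ← Real.exp_add]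
          refine ENNReal.ofReal_le_ofReal (Real.exp_le_exp.2 ?_)
          have := mul_le_mul_of_nonneg_right hle
            (sq_nonneg ‖x + ∑ i ∈ Finset.range r, Z i ω‖)
          linarith
      _ ≤ ENNReal.ofReal (Real.exp (c * σ ^ 2)) * ENNReal.ofReal (Real.exp
            ((c' * ‖x‖ ^ 2 + c' * r * σ ^ 2) / (1 - 8 * c' * r * σ ^ 2))) := by
          rw [lintegral_const_mul' _ _ ENNReal.ofReal_ne_top]
          gcongr
          exact ih hc'0 (by linarith)
      _ ≤ _ := by
          rw [← ENNReal.ofReal_mul (Real.exp_pos _).le, ← Real.exp_add]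
          refine ENNReal.ofReal_le_ofReal (Real.exp_le_exp.2 ?_)
          have e : (c' * ‖x‖ ^ 2 + c' * r * σ ^ 2) / (1 - 8 * c' * r * σ ^ 2) =
              (c * ‖x‖ ^ 2 + c * r * σ ^ 2) / (1 - 8 * c * (r + 1) * σ ^ 2) := by
            rw [hc'1, hc']
            generalize 1 - 8 * c * σ ^ 2 = a at h8
            field_simp
          rw [e]
          have h10 : c * σ ^ 2 ≤ c * σ ^ 2 / (1 - 8 * c * (r + 1) * σ ^ 2) := by
            rw [le_div_iff₀ h9]; nlinarith
          have h11 : (c * ‖x‖ ^ 2 + c * (r + 1) * σ ^ 2) / (1 - 8 * c * (r + 1) * σ ^ 2) =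
            (c * ‖x‖ ^ 2 + c * r * σ ^ 2) / (1 - 8 * c * (r + 1) * σ ^ 2) +
              c * σ ^ 2 / (1 - 8 * c * (r + 1) * σ ^ 2) := by ring
          rw [h11]; linarith

/-- A batch of `r` light-tailed vectors has an average that is light-tailed with parameter
`σ² / r`, independently of the dimension. -/
theorem lintegral_exp_inner_average_le {Z : ℕ → Ω → E} (hZ : ∀ i, IsLightTailed P (Z i) σ)
    (hind : iIndepFun Z P) (hσ : 0 < σ) (v : E) {r : ℕ} (hr : 0 < r) {c : ℝ} (hc : 0 < c)
    (hc1 : 16 * c * (σ ^ 2 / r) ≤ 1) :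
    ∫⁻ ω, ENNReal.ofReal (Real.exp (inner ℝ v ((r : ℝ)⁻¹ • ∑ i ∈ Finset.range r, Z i ω) +
        c * ‖(r : ℝ)⁻¹ • ∑ i ∈ Finset.range r, Z i ω‖ ^ 2)) ∂P ≤
      ENNReal.ofReal (Real.exp (4 * (σ ^ 2 / r) * ‖v‖ ^ 2 + 2 * c * (σ ^ 2 / r))) := by
  have hr' : (0 : ℝ) < r := by exact_mod_cast hr
  set q : ℝ := σ ^ 2 / r with hq
  have hq0 : 0 < q := by positivity
  have e0 : c / (r : ℝ) ^ 2 * r * σ ^ 2 = c * q := by rw [hq]; field_simp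
  have e1 : 8 * (c / (r : ℝ) ^ 2) * r * σ ^ 2 = 8 * c * q := by rw [hq]; field_simp
  have h := lintegral_exp_sq_add_sum_le hZ hind hσ (((r : ℝ) / (2 * c)) • v) r
    (c := c / (r : ℝ) ^ 2) (by positivity) (by rw [e1]; linarith)
  rw [e1, e0] at h
  have e2 : c / (r : ℝ) ^ 2 * ‖((r : ℝ) / (2 * c)) • v‖ ^ 2 = ‖v‖ ^ 2 / (4 * c) := by
    rw [norm_smul, mul_pow, Real.norm_eq_abs, sq_abs]; field_simp; ring
  rw [e2] at h
  -- Completing the square turns the linear term into a shift, to which the bound for shifted sums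
  -- applies.
  have e3 : ∀ T : E, inner ℝ v ((r : ℝ)⁻¹ • T) + c * ‖(r : ℝ)⁻¹ • T‖ ^ 2 =
      -(‖v‖ ^ 2 / (4 * c)) + c / (r : ℝ) ^ 2 * ‖((r : ℝ) / (2 * c)) • v + T‖ ^ 2 := fun T => by
    rw [norm_add_sq_real, norm_smul, norm_smul, mul_pow, mul_pow, Real.norm_eq_abs,
      Real.norm_eq_abs, sq_abs, sq_abs, real_inner_smul_left, real_inner_smul_right]
    field_simp; ring
  simp_rw [e3, Real.exp_add, ENNReal.ofReal_mul (Real.exp_pos _).le]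
  rw [lintegral_const_mul' _ _ ENNReal.ofReal_ne_top]
  refine (mul_le_mul_right h _).trans ?_
  rw [← ENNReal.ofReal_mul (Real.exp_pos _).le, ← ENNReal.ofReal_mul (Real.exp_pos _).le,
    ← Real.exp_add, ← Real.exp_add]
  refine ENNReal.ofReal_le_ofReal (Real.exp_le_exp.2 ?_)
  have h9 : 0 < 1 - 8 * c * q := by linarith
  have e4 : -(‖v‖ ^ 2 / (4 * c)) + (‖v‖ ^ 2 / (4 * c) + c * q) / (1 - 8 * c * q) =
      (2 * q * ‖v‖ ^ 2 + c * q) / (1 - 8 * c * q) := by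
    rw [eq_div_iff h9.ne', add_mul, div_mul_cancel₀ _ h9.ne']
    field_simp; ring
  rw [e4, div_le_iff₀ h9]
  have : 0 ≤ 2 * q * ‖v‖ ^ 2 + c * q := by positivity
  nlinarith

end Subgaussian

/-! ### The convex conjugate of a strongly convex function. -/

section Conjugate

variable {n m : ℕ} {f : Vec n → ℝ} {μ : ℝ}

/-- Strong convexity at `t x' + (1-t) x`, combined with the subgradient inequality there, is divided
by `t` before `t → 0⁺`. -/
theorem StrongConvexOn.add_sq_le_of_isSubgradientAt (hf : StrongConvexOn Set.univ μ f)
    {g x : Vec n} (hg : IsSubgradientAt f g x) (x' : Vec n) :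
    f x + inner ℝ g (x' - x) + μ / 2 * ‖x' - x‖ ^ 2 ≤ f x' := by
  have key : ∀ t ∈ Set.Ioo (0 : ℝ) 1,
      f x + inner ℝ g (x' - x) + (1 - t) * (μ / 2 * ‖x' - x‖ ^ 2) ≤ f x' := by
    rintro t ⟨h0, h1⟩
    have h := hf.2 (Set.mem_univ x') (Set.mem_univ x) h0.le (sub_nonneg.2 h1.le) (by ring)
    have hs := hg (t • x' + (1 - t) • x)
    have e : t • x' + (1 - t) • x - x = t • (x' - x) := by module
    rw [e, real_inner_smul_right] at hs
    simp only [smul_eq_mul] at h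
    have : t * (f x + inner ℝ g (x' - x) + (1 - t) * (μ / 2 * ‖x' - x‖ ^ 2)) ≤ t * f x' := by
      nlinarith
    exact le_of_mul_le_mul_left this h0
  have hlim : Filter.Tendsto
      (fun t : ℝ => f x + inner ℝ g (x' - x) + (1 - t) * (μ / 2 * ‖x' - x‖ ^ 2))
      (nhdsWithin 0 (Set.Ioi 0))
      (nhds (f x + inner ℝ g (x' - x) + (1 - 0) * (μ / 2 * ‖x' - x‖ ^ 2))) :=
    (Continuous.tendsto (by fun_prop) 0).mono_left nhdsWithin_le_nhds
  rw [sub_zero, one_mul] at hlim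
  exact le_of_tendsto hlim (Filter.eventually_of_mem (Ioo_mem_nhdsGT one_pos) key)

theorem StrongConvexOn.continuous_of_univ (hμ : 0 ≤ μ) (hf : StrongConvexOn Set.univ μ f) :
    Continuous f := by
  have hc : ConvexOn ℝ Set.univ f := hf.convexOn fun r => by positivity
  exact continuousOn_univ.1 (hc.continuousOn isOpen_univ)

/-- One subgradient already forces quadratic growth, so `f - ⟨u, ·⟩` exceeds its value at `x₀`
outside a ball, and continuity gives a minimizer. -/
theorem StrongConvexOn.exists_isMaxOn_inner_sub (hμ : 0 < μ) (hf : StrongConvexOn Set.univ μ f)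
    {g x₀ : Vec n} (hg : IsSubgradientAt f g x₀) (u : Vec n) :
    ∃ x, IsMaxOn (fun x' => inner ℝ u x' - f x') Set.univ x := by
  have hcont : Continuous fun x' : Vec n => f x' - inner ℝ u x' := by
    have := hf.continuous_of_univ hμ.le
    fun_prop
  have hev : ∀ᶠ x' in Filter.cocompact (Vec n),
      f x₀ - inner ℝ u x₀ ≤ f x' - inner ℝ u x' := by
    have h := (tendsto_norm_cocompact_atTop (E := Vec n)).eventually_ge_atTop
      (‖x₀‖ + 2 * ‖g - u‖ / μ)
    filter_upwards [h] with x' hx'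
    have h1 := hf.add_sq_le_of_isSubgradientAt hg x'
    have h2 : inner ℝ (g - u) (x' - x₀) = inner ℝ g (x' - x₀) - (inner ℝ u x' - inner ℝ u x₀) := by
      rw [inner_sub_left, inner_sub_right u]
    have h3 := (abs_le.1 (abs_real_inner_le_norm (g - u) (x' - x₀))).1
    have h4 : 2 * ‖g - u‖ / μ ≤ ‖x' - x₀‖ := by
      have := norm_sub_norm_le x' x₀
      linarith
    rw [div_le_iff₀ hμ] at h4
    nlinarith [norm_nonneg (x' - x₀)]
  obtain ⟨x, hx⟩ := hcont.exists_forall_le' x₀ hev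
  exact ⟨x, fun x' _ => by have := hx x'; simp only [Set.mem_ofPred_eq]; linarith⟩

/-- `f` is strongly convex and has a subgradient somewhere. -/
structure IsStrongConvexWithSubgradient (f : Vec n → ℝ) (μ : ℝ) : Prop where
  pos : 0 < μ
  strong : StrongConvexOn Set.univ μ f
  exists_subgradient : ∃ g x, IsSubgradientAt f g x

namespace IsStrongConvexWithSubgradient

variable (hf : IsStrongConvexWithSubgradient f μ)
include hf

theorem isMaxOn_argDual (u : Vec n) :
    IsMaxOn (fun x' => inner ℝ u x' - f x') Set.univ (argDual f u) := by
  obtain ⟨g, x, h⟩ := hf.exists_subgradient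
  exact Classical.epsilon_spec (hf.strong.exists_isMaxOn_inner_sub hf.pos h u)

theorem isSubgradientAt_argDual (u : Vec n) : IsSubgradientAt f u (argDual f u) := fun x' => by
  have := hf.isMaxOn_argDual u (Set.mem_univ x')
  simp only [Set.mem_ofPred_eq] at this
  rw [inner_sub_right]; linarith

theorem dualPhi_eq (u : Vec n) :
    dualPhi f u = inner ℝ u (argDual f u) - f (argDual f u) :=
  le_antisymm (ciSup_le fun x => hf.isMaxOn_argDual u (Set.mem_univ x))
    (le_ciSup (f := fun x => inner ℝ u x - f x)
      ⟨_, by rintro _ ⟨x, rfl⟩; exact hf.isMaxOn_argDual u (Set.mem_univ x)⟩ (argDual f u))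

theorem le_dualPhi (u x : Vec n) : inner ℝ u x - f x ≤ dualPhi f u := by
  rw [hf.dualPhi_eq]; exact hf.isMaxOn_argDual u (Set.mem_univ x)

/-- Adding the quadratic lower bounds at the two maximizers gives strong monotonicity;
Cauchy–Schwarz does the rest. -/
theorem norm_argDual_sub_le (u u' : Vec n) :
    μ * ‖argDual f u - argDual f u'‖ ≤ ‖u - u'‖ := by
  have hμ := hf.pos
  have h1 := hf.strong.add_sq_le_of_isSubgradientAt (hf.isSubgradientAt_argDual u) (argDual f u')
  have h2 := hf.strong.add_sq_le_of_isSubgradientAt (hf.isSubgradientAt_argDual u') (argDual f u)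
  rw [norm_sub_rev] at h1
  have h3 : inner ℝ (u - u') (argDual f u - argDual f u') =
      -inner ℝ u (argDual f u' - argDual f u) - inner ℝ u' (argDual f u - argDual f u') := by
    rw [← neg_sub (argDual f u), inner_neg_right, inner_sub_left]; ring
  have h4 := real_inner_le_norm (u - u') (argDual f u - argDual f u')
  rcases (norm_nonneg (argDual f u - argDual f u')).eq_or_lt' with h | h
  · rw [h]; simp
  · refine le_of_mul_le_mul_right ?_ h
    nlinarith

theorem continuous_argDual : Continuous (argDual f) := by
  refine (LipschitzWith.of_dist_le_mul (K := μ⁻¹.toNNReal) fun u u' => ?_).continuous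
  rw [dist_eq_norm, dist_eq_norm, Real.coe_toNNReal _ (inv_pos.2 hf.pos).le, ← div_eq_inv_mul, le_div_iff₀ hf.pos, mul_comm]
  exact hf.norm_argDual_sub_le u u'

theorem dualPhi_add_inner_le (u u' : Vec n) :
    dualPhi f u + inner ℝ (u' - u) (argDual f u) ≤ dualPhi f u' := by
  refine le_trans (le_of_eq ?_) (hf.le_dualPhi u' (argDual f u))
  rw [hf.dualPhi_eq, inner_sub_left]; ring

theorem dualPhi_le (u u' : Vec n) :
    dualPhi f u' ≤ dualPhi f u + inner ℝ (u' - u) (argDual f u) + ‖u' - u‖ ^ 2 / (2 * μ) := by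
  have hμ := hf.pos
  have h1 := hf.strong.add_sq_le_of_isSubgradientAt (hf.isSubgradientAt_argDual u) (argDual f u')
  rw [hf.dualPhi_eq u, hf.dualPhi_eq u']
  set x := argDual f u
  set x' := argDual f u'
  have h2 : inner ℝ u' x' = inner ℝ u x + inner ℝ u (x' - x) + inner ℝ (u' - u) x +
      inner ℝ (u' - u) (x' - x) := by
    simp only [inner_sub_left, inner_sub_right]; ring
  have h3 := real_inner_le_norm (u' - u) (x' - x)
  have h4 : ‖u' - u‖ * ‖x' - x‖ ≤ ‖u' - u‖ ^ 2 / (2 * μ) + μ / 2 * ‖x' - x‖ ^ 2 := by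
    have : ‖u' - u‖ ^ 2 / (2 * μ) + μ / 2 * ‖x' - x‖ ^ 2 - ‖u' - u‖ * ‖x' - x‖ =
      (‖u' - u‖ - μ * ‖x' - x‖) ^ 2 / (2 * μ) := by field_simp; ring
    have h0 : 0 ≤ (‖u' - u‖ - μ * ‖x' - x‖) ^ 2 / (2 * μ) := by positivity
    linarith
  linarith

end IsStrongConvexWithSubgradient

end Conjugate

/-! ### Spectral bounds from an orthonormal eigenbasis of `AᵀA`. -/

section Spectral

variable {n m : ℕ} (A : Vec n →L[ℝ] Vec m)

theorem isSymmetric_gram :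
    ((tr A ∘L A : Vec n →L[ℝ] Vec n) : Vec n →ₗ[ℝ] Vec n).IsSymmetric := fun x y => by
  simp [ContinuousLinearMap.adjoint_inner_left, ContinuousLinearMap.adjoint_inner_right]

theorem exists_orthonormalBasis_gram :
    ∃ (b : OrthonormalBasis (Fin n) ℝ (Vec n)) (l : Fin n → ℝ),
      (∀ i, l i ∈ gramEigenvalues A) ∧ (∀ i, 0 ≤ l i) ∧
      (∀ v i, b.repr (tr A (A v)) i = l i * b.repr v i) := by
  have hn : Module.finrank ℝ (Vec n) = n := by simp
  have hT := isSymmetric_gram A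
  refine ⟨hT.eigenvectorBasis hn, hT.eigenvalues hn, fun i => hT.hasEigenvalue_eigenvalues hn i,
    fun i => eigenvalue_nonneg_of_nonneg (hT.hasEigenvalue_eigenvalues hn i) fun x => ?_,
    fun v i => ?_⟩
  · simp [ContinuousLinearMap.adjoint_inner_right]
  · exact hT.eigenvectorBasis_apply_self_apply hn v i

theorem finite_gramEigenvalues : (gramEigenvalues A).Finite :=
  Module.End.finite_hasEigenvalue _

theorem sq_norm_apply_eq {b : OrthonormalBasis (Fin n) ℝ (Vec n)} {l : Fin n → ℝ}
    (h : ∀ v i, b.repr (tr A (A v)) i = l i * b.repr v i) (v : Vec n) :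
    ‖A v‖ ^ 2 = ∑ i, l i * b.repr v i ^ 2 := by
  rw [← real_inner_self_eq_norm_sq, ← ContinuousLinearMap.adjoint_inner_right,
    ← b.repr.inner_map_map, PiLp.inner_apply]
  refine Finset.sum_congr rfl fun i _ => ?_
  rw [h]; simp; ring

theorem sq_norm_eq_sum (b : OrthonormalBasis (Fin n) ℝ (Vec n)) (v : Vec n) :
    ‖v‖ ^ 2 = ∑ i, b.repr v i ^ 2 := by
  rw [← b.repr.norm_map, EuclideanSpace.norm_sq_eq]; simp

theorem lamMax_nonneg : 0 ≤ lamMax A := by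
  refine Real.sSup_nonneg fun t ht => ?_
  exact eigenvalue_nonneg_of_nonneg ht fun x => by
    simp [ContinuousLinearMap.adjoint_inner_right]

theorem norm_apply_le (v : Vec n) : ‖A v‖ ≤ √(lamMax A) * ‖v‖ := by
  obtain ⟨b, l, hl, -, h⟩ := exists_orthonormalBasis_gram A
  refine le_of_sq_le_sq ?_ (by positivity)
  rw [mul_pow, Real.sq_sqrt (lamMax_nonneg A), sq_norm_apply_eq A h, sq_norm_eq_sum b,
    Finset.mul_sum]
  gcongr with i
  exact le_csSup (finite_gramEigenvalues A).bddAbove (hl i)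

theorem norm_tr_apply_le (y : Vec m) : ‖tr A y‖ ≤ √(lamMax A) * ‖y‖ := by
  have h : ‖tr A‖ ≤ √(lamMax A) := by
    rw [LinearIsometryEquiv.norm_map]
    exact A.opNorm_le_bound (Real.sqrt_nonneg _) (norm_apply_le A)
  exact ((tr A).le_opNorm y).trans (by gcongr)

/-- In the eigenbasis this is `λ⁺_min · l ≤ l²` for each eigenvalue `l`, zero eigenvalues being
harmless. -/
theorem lamMinPos_mul_sq_norm_apply_le (v : Vec n) :
    lamMinPos A * ‖A v‖ ^ 2 ≤ ‖tr A (A v)‖ ^ 2 := by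
  obtain ⟨b, l, hl, h0, h⟩ := exists_orthonormalBasis_gram A
  rw [sq_norm_apply_eq A h, sq_norm_eq_sum b, Finset.mul_sum]
  refine Finset.sum_le_sum fun i _ => ?_
  rw [h, mul_pow, ← mul_assoc, sq (l i)]
  rcases (h0 i).eq_or_lt' with h1 | h1
  · simp [h1]
  · gcongr
    exact csInf_le ⟨0, fun t ht => ht.2.le⟩ ⟨hl i, h1⟩

theorem lamMinPos_nonneg : 0 ≤ lamMinPos A := Real.sInf_nonneg fun _ ht => ht.2.le

/-- If no eigenvalue is positive, the infimum is over the empty set and takes the default value `0`;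
this happens only for `A = 0`. -/
theorem lamMinPos_pos_or : 0 < lamMinPos A ∨ A = 0 := by
  obtain ⟨b, l, hl, h0, h⟩ := exists_orthonormalBasis_gram A
  by_cases hne : {t ∈ gramEigenvalues A | 0 < t}.Nonempty
  · exact Or.inl (hne.csInf_mem ((finite_gramEigenvalues A).subset (Set.sep_subset _ _))).2
  · refine Or.inr (ContinuousLinearMap.ext fun v => ?_)
    have hz : ∀ i, l i = 0 := fun i => by
      by_contra hi
      exact hne ⟨l i, hl i, (h0 i).lt_of_ne' hi⟩
    have := sq_norm_apply_eq A h v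
    simp only [hz, zero_mul, Finset.sum_const_zero] at this
    simpa using this

theorem lamMinPos_le_lamMax : lamMinPos A ≤ lamMax A := by
  by_cases hne : {t ∈ gramEigenvalues A | 0 < t}.Nonempty
  · have h := hne.csInf_mem ((finite_gramEigenvalues A).subset (Set.sep_subset _ _))
    exact le_csSup (finite_gramEigenvalues A).bddAbove h.1
  · rw [lamMinPos, Set.not_nonempty_iff_eq_empty.1 hne, Real.sInf_empty]
    exact lamMax_nonneg A

/-- For the self-adjoint `AᵀA` the orthogonal complement of the kernel is the range, and `AᵀA v = 0`
implies `A v = 0`. -/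
theorem exists_tr_apply_apply_eq {g : Vec n} (hg : ∀ v, A v = 0 → inner ℝ g v = 0) :
    ∃ v, tr A (A v) = g := by
  have hT := isSymmetric_gram A
  have h := LinearMap.orthogonal_ker ((tr A ∘L A : Vec n →L[ℝ] Vec n) : Vec n →ₗ[ℝ] Vec n)
  rw [LinearMap.isSelfAdjoint_iff'.1 (LinearMap.isSymmetric_iff_isSelfAdjoint _ |>.1 hT)] at h
  have hmem : g ∈ (LinearMap.ker ((tr A ∘L A : Vec n →L[ℝ] Vec n) : Vec n →ₗ[ℝ] Vec n))ᗮ := by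
    rw [Submodule.mem_orthogonal']
    intro v hv
    refine hg v ?_
    have hv' : tr A (A v) = 0 := by simpa using hv
    have : ‖A v‖ ^ 2 = 0 := by
      rw [← real_inner_self_eq_norm_sq, ← ContinuousLinearMap.adjoint_inner_right]
      change inner ℝ v (tr A (A v)) = 0
      rw [hv', inner_zero_right]
    simpa using this
  rw [h] at hmem
  obtain ⟨v, hv⟩ := hmem
  exact ⟨v, by simpa using hv⟩

end Spectral

/-! ### Quadratic growth of `A_k`. -/

section StepSizes

variable {L : ℝ}

theorem accA_bounds (hL : 0 < L) (k : ℕ) :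
    (k : ℝ) ^ 2 / (8 * L) ≤ accA L k ∧ accA L k ≤ (k : ℝ) ^ 2 / (2 * L) ∧
      stepSucc L k ≤ (k + 1) / (2 * L) := by
  have hstep : ∀ k : ℕ, (k : ℝ) ^ 2 / (8 * L) ≤ accA L k → accA L k ≤ (k : ℝ) ^ 2 / (2 * L) →
      (k + 1) / (4 * L) ≤ stepSucc L k ∧ stepSucc L k ≤ (k + 1) / (2 * L) := by
    intro k h1 h2
    rw [div_le_iff₀ (by positivity)] at h1
    rw [le_div_iff₀ (by positivity)] at h2
    have hk : (0 : ℝ) ≤ k := k.cast_nonneg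
    have h3 : (k : ℝ) ≤ √(1 + 8 * L * accA L k) := Real.le_sqrt_of_sq_le (by nlinarith)
    have h4 : √(1 + 8 * L * accA L k) ≤ 1 + 2 * k :=
      Real.sqrt_le_iff.2 ⟨by positivity, by nlinarith⟩
    unfold stepSucc nextStep
    constructor <;> rw [div_le_div_iff₀ (by positivity) (by positivity)] <;> nlinarith
  have main : (k : ℝ) ^ 2 / (8 * L) ≤ accA L k ∧ accA L k ≤ (k : ℝ) ^ 2 / (2 * L) := by
    induction k with
    | zero => simp [accA]
    | succ k ih =>
      obtain ⟨h1, h2⟩ := hstep k ih.1 ih.2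
      have e : accA L (k + 1) = accA L k + stepSucc L k := rfl
      obtain ⟨h3, h4⟩ := ih
      have hk : (0 : ℝ) ≤ k := k.cast_nonneg
      rw [div_le_iff₀ (by positivity)] at h1 h3
      rw [le_div_iff₀ (by positivity)] at h2 h4
      rw [e, div_le_iff₀ (by positivity), le_div_iff₀ (by positivity)]
      push_cast
      constructor <;> nlinarith
  exact ⟨main.1, main.2, (hstep k main.1 main.2).2⟩

theorem accA_nonneg (hL : 0 < L) (k : ℕ) : 0 ≤ accA L k :=
  le_trans (by positivity) (accA_bounds hL k).1

theorem stepSucc_pos (hL : 0 < L) (k : ℕ) : 0 < stepSucc L k := nextStep_pos hL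

theorem accA_succ (L : ℝ) (k : ℕ) : accA L (k + 1) = accA L k + stepSucc L k := rfl

theorem accA_succ_pos (hL : 0 < L) (k : ℕ) : 0 < accA L (k + 1) :=
  add_pos_of_nonneg_of_pos (accA_nonneg hL k) (stepSucc_pos hL k)

theorem two_mul_stepSucc_sq (hL : 0 < L) (k : ℕ) :
    2 * L * stepSucc L k ^ 2 = accA L (k + 1) := nextStep_eq hL (accA_nonneg hL k)

theorem accA_eq_sum (L : ℝ) (k : ℕ) : accA L k = ∑ j ∈ Finset.range k, stepSucc L j := by
  induction k with
  | zero => rfl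
  | succ k ih => rw [Finset.sum_range_succ, ← ih, accA_succ]

end StepSizes

/-! ### One deterministic step with an inexact gradient. -/

section SimilarTriangles

variable {n m : ℕ}

/-- One step of the method of similar triangles with an inexact gradient `g` of `ψ` at `q`. -/
theorem similar_triangles_step {ψ : Vec m → ℝ} {l a α : ℝ} (hα : 0 < α) (ha : 0 ≤ a)
    (hl : 4 * l * α ^ 2 = a + α) {y z q g d z' y' : Vec m}
    (hq : q = (a + α)⁻¹ • (a • y + α • z)) (hz' : z' = z - α • g)
    (hy' : y' = (a + α)⁻¹ • (a • y + α • z'))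
    (hsmooth : ψ y' ≤ ψ q + inner ℝ d (y' - q) + l / 2 * ‖y' - q‖ ^ 2)
    (hconv : ψ q + inner ℝ d (y - q) ≤ ψ y) (u : Vec m) :
    (a + α) * ψ y' + ‖z' - u‖ ^ 2 / 2 ≤ a * ψ y + ‖z - u‖ ^ 2 / 2 +
      α * (ψ q + inner ℝ d (u - q)) + (α * inner ℝ (g - d) (u - z) + α ^ 2 * ‖g - d‖ ^ 2) := by
  have hs : 0 < a + α := by positivity
  have e1 : y' - q = (-(α ^ 2 / (a + α))) • g := by
    rw [hy', hq, hz']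
    match_scalars <;> field_simp <;> ring
  have e2 : a * inner ℝ d (y - q) = α * inner ℝ d (q - z) := by
    rw [← real_inner_smul_right, ← real_inner_smul_right]
    congr 1
    rw [hq]
    match_scalars <;> field_simp <;> ring
  have e3 : (a + α) * inner ℝ d (y' - q) = -(α ^ 2 * inner ℝ d g) := by
    rw [e1, real_inner_smul_right]; field_simp
  -- The doubled step constant makes the smoothness term `α²‖g‖²/8`. With `α²‖g‖²/2` from the
  -- distance, it remains to dominate `5/8 ‖g‖² - ⟨d, g⟩` by `‖g - d‖²`, which holds because `3/8
  -- ‖g‖² - ⟨d, g⟩ + ‖d‖²` is a nonnegative quadratic form. Without the doubling that form would be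
  -- indefinite.
  have e4 : (a + α) * (l / 2 * ‖y' - q‖ ^ 2) = α ^ 2 * ‖g‖ ^ 2 / 8 := by
    rw [e1, norm_smul, mul_pow, Real.norm_eq_abs, sq_abs]
    field_simp
    linear_combination 2 * ‖g‖ ^ 2 * hl
  have e5 : ‖z' - u‖ ^ 2 = ‖z - u‖ ^ 2 - 2 * α * inner ℝ g (z - u) + α ^ 2 * ‖g‖ ^ 2 := by
    have : z' - u = (z - u) - α • g := by rw [hz']; abel
    rw [this, norm_sub_sq_real, norm_smul, mul_pow, Real.norm_eq_abs, sq_abs,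
      real_inner_smul_right, real_inner_comm]; ring
  have h1 := mul_le_mul_of_nonneg_left hsmooth hs.le
  have h2 := mul_le_mul_of_nonneg_left hconv ha
  have e6 : ‖g - d‖ ^ 2 = ‖g‖ ^ 2 - 2 * inner ℝ d g + ‖d‖ ^ 2 := by
    rw [norm_sub_sq_real, real_inner_comm]
  have e7 : inner ℝ (g - d) (u - z) = -inner ℝ g (z - u) + inner ℝ d (z - u) := by
    rw [← neg_sub z u, inner_neg_right, inner_sub_left]; ring
  have e8 : inner ℝ d (u - q) = inner ℝ d (q - z) * (-1) - inner ℝ d (z - u) := by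
    simp only [inner_sub_right]; ring
  have h3 : 0 ≤ ‖(5 / 8 : ℝ) • g - d‖ ^ 2 := sq_nonneg _
  have e9 : ‖(5 / 8 : ℝ) • g - d‖ ^ 2 = 25 / 64 * ‖g‖ ^ 2 - 5 / 4 * inner ℝ d g + ‖d‖ ^ 2 := by
    rw [norm_sub_sq_real, norm_smul, real_inner_smul_left, real_inner_comm, Real.norm_eq_abs,
      abs_of_pos (by norm_num : (0 : ℝ) < 5 / 8)]; ring
  have h4 : 0 ≤ ‖g - (2 : ℝ) • d‖ ^ 2 := sq_nonneg _
  have e10 : ‖g - (2 : ℝ) • d‖ ^ 2 = ‖g‖ ^ 2 - 4 * inner ℝ d g + 4 * ‖d‖ ^ 2 := by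
    rw [norm_sub_sq_real, norm_smul, real_inner_smul_right, real_inner_comm, Real.norm_eq_abs,
      abs_two]; ring
  have h5 : 0 ≤ ‖g‖ ^ 2 - 2 * inner ℝ d g + ‖d‖ ^ 2 - (5 / 8 * ‖g‖ ^ 2 - inner ℝ d g) := by
    nlinarith [sq_nonneg ‖g‖, sq_nonneg ‖d‖]
  have h6 := mul_nonneg (sq_nonneg α) h5
  rw [e6, e7, e8, e5]
  nlinarith

variable {f : Vec n → ℝ} {μ : ℝ} {A : Vec n →L[ℝ] Vec m}

theorem IsStrongConvexWithSubgradient.dualPsi_add_inner_le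
    (hf : IsStrongConvexWithSubgradient f μ) (A : Vec n →L[ℝ] Vec m) (q y : Vec m) :
    dualPsi f A q + inner ℝ (A (argDual f (tr A q))) (y - q) ≤ dualPsi f A y := by
  have := hf.dualPhi_add_inner_le (tr A q) (tr A y)
  rwa [← map_sub, ContinuousLinearMap.adjoint_inner_left, real_inner_comm] at this

theorem IsStrongConvexWithSubgradient.dualPsi_eq
    (hf : IsStrongConvexWithSubgradient f μ) (A : Vec n →L[ℝ] Vec m) (q u : Vec m) :
    dualPsi f A q + inner ℝ (A (argDual f (tr A q))) (u - q) =
      inner ℝ (A (argDual f (tr A q))) u - f (argDual f (tr A q)) := by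
  rw [dualPsi, hf.dualPhi_eq, ContinuousLinearMap.adjoint_inner_left, inner_sub_right,
    real_inner_comm q]
  ring

theorem IsStrongConvexWithSubgradient.dualPsi_le
    (hf : IsStrongConvexWithSubgradient f μ) {A : Vec n →L[ℝ] Vec m} {lam : ℝ} (hlam : 0 ≤ lam)
    (hA : ∀ y, ‖tr A y‖ ≤ √lam * ‖y‖) (q y : Vec m) :
    dualPsi f A y ≤ dualPsi f A q + inner ℝ (A (argDual f (tr A q))) (y - q) +
      lam / μ / 2 * ‖y - q‖ ^ 2 := by
  have h := hf.dualPhi_le (tr A q) (tr A y)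
  rw [← map_sub, ContinuousLinearMap.adjoint_inner_left, real_inner_comm] at h
  have h1 : ‖tr A (y - q)‖ ^ 2 ≤ lam * ‖y - q‖ ^ 2 := by
    have := pow_le_pow_left₀ (norm_nonneg _) (hA (y - q)) 2
    rwa [mul_pow, Real.sq_sqrt hlam] at this
  have hμ := hf.pos
  have h2 : ‖tr A (y - q)‖ ^ 2 / (2 * μ) ≤ lam / μ / 2 * ‖y - q‖ ^ 2 := by
    rw [div_le_iff₀ (by positivity)]
    have : lam / μ / 2 * ‖y - q‖ ^ 2 * (2 * μ) = lam * ‖y - q‖ ^ 2 := by field_simp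
    linarith
  change dualPhi f (tr A y) ≤ dualPhi f (tr A q) + _ + _
  linarith

theorem spdstmState_succ_snd (L : ℝ) (grad : ℕ → Vec m → Vec m) (k : ℕ) :
    (spdstmState L grad (k + 1)).2 = (spdstmState L grad k).2 -
      stepSucc L k • grad k (midPoint L k (spdstmState L grad k)) := rfl

theorem spdstmState_succ_fst (L : ℝ) (grad : ℕ → Vec m → Vec m) (k : ℕ) :
    (spdstmState L grad (k + 1)).1 = (accA L (k + 1))⁻¹ • (accA L k • (spdstmState L grad k).1 +
      stepSucc L k • (spdstmState L grad (k + 1)).2) := rfl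

theorem spdstmState_snd_eq_sum (L : ℝ) (grad : ℕ → Vec m → Vec m) (k : ℕ) :
    (spdstmState L grad k).2 = -∑ j ∈ Finset.range k,
      stepSucc L j • grad j (midPoint L j (spdstmState L grad j)) := by
  induction k with
  | zero => simp [spdstmState]
  | succ k ih => rw [spdstmState_succ_snd, Finset.sum_range_succ, ih]; abel

theorem spdstm_step (hf : IsStrongConvexWithSubgradient f μ) {lam L : ℝ}
    (hlam : 0 < lam) (hA : ∀ y, ‖tr A y‖ ≤ √lam * ‖y‖) (hL : L = 2 * (lam / μ))
    (grad : ℕ → Vec m → Vec m) (k : ℕ) (u : Vec m) {x : Vec n} {e : Vec m}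
    (hx : x = argDual f (tr A (midPoint L k (spdstmState L grad k))))
    (he : e = grad k (midPoint L k (spdstmState L grad k)) - A x) :
    accA L (k + 1) * dualPsi f A (spdstmState L grad (k + 1)).1 +
        ‖(spdstmState L grad (k + 1)).2 - u‖ ^ 2 / 2 ≤
      accA L k * dualPsi f A (spdstmState L grad k).1 + ‖(spdstmState L grad k).2 - u‖ ^ 2 / 2 +
      stepSucc L k * (dualPsi f A (midPoint L k (spdstmState L grad k)) +
        inner ℝ (A x) (u - midPoint L k (spdstmState L grad k))) +
      (stepSucc L k * inner ℝ e (u - (spdstmState L grad k).2) +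
        stepSucc L k ^ 2 * ‖e‖ ^ 2) := by
  have hμ := hf.pos
  have hL0 : 0 < L := by rw [hL]; positivity
  have h2 := two_mul_stepSucc_sq hL0 k
  rw [he]
  refine similar_triangles_step (ψ := dualPsi f A) (l := lam / μ) (stepSucc_pos hL0 k)
    (accA_nonneg hL0 k) ?_ rfl rfl rfl ?_ ?_ u
  · rw [← accA_succ, ← h2, hL]; ring
  · rw [hx]; exact hf.dualPsi_le hlam.le hA _ _
  · rw [hx]; exact hf.dualPsi_add_inner_le A _ _

/-- Balls are convex: since `y^k` and the query points are averages of the `z^j`, only the `z^j`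
ever need to be controlled. -/
theorem norm_smul_add_smul_sub_le {a α ρ : ℝ} (ha : 0 ≤ a) (hα : 0 < α) {y z u : Vec m}
    (hy : ‖y - u‖ ≤ ρ) (hz : ‖z - u‖ ≤ ρ) : ‖(a + α)⁻¹ • (a • y + α • z) - u‖ ≤ ρ := by
  have hs : 0 < a + α := by positivity
  have e : (a + α)⁻¹ • (a • y + α • z) - u = (a + α)⁻¹ • (a • (y - u) + α • (z - u)) := by
    match_scalars <;> field_simp
    ring
  rw [e, norm_smul, Real.norm_eq_abs, abs_of_pos (by positivity), inv_mul_le_iff₀ hs]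
  refine (norm_add_le _ _).trans ?_
  rw [norm_smul, norm_smul, Real.norm_eq_abs, Real.norm_eq_abs, abs_of_nonneg ha,
    abs_of_pos hα]
  nlinarith

theorem norm_spdstmState_fst_sub_le {L : ℝ} (hL : 0 < L) (grad : ℕ → Vec m → Vec m) {u : Vec m}
    {ρ : ℝ} {k : ℕ} (h : ∀ j ≤ k, ‖(spdstmState L grad j).2 - u‖ ≤ ρ) :
    ‖(spdstmState L grad k).1 - u‖ ≤ ρ := by
  induction k with
  | zero => exact h 0 le_rfl
  | succ k ih =>
    rw [spdstmState_succ_fst]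
    exact norm_smul_add_smul_sub_le (accA_nonneg hL k) (stepSucc_pos hL k)
      (ih fun j hj => h j (by omega)) (h _ le_rfl)

theorem norm_midPoint_sub_le {L : ℝ} (hL : 0 < L) (grad : ℕ → Vec m → Vec m) {u : Vec m}
    {ρ : ℝ} {k : ℕ} (h : ∀ j ≤ k, ‖(spdstmState L grad j).2 - u‖ ≤ ρ) :
    ‖midPoint L k (spdstmState L grad k) - u‖ ≤ ρ :=
  norm_smul_add_smul_sub_le (accA_nonneg hL k) (stepSucc_pos hL k)
    (norm_spdstmState_fst_sub_le hL grad h) (h k le_rfl)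

end SimilarTriangles

/-! ### The error potential and its self-bounding increments. -/

noncomputable section ErrorProcess

variable {n m : ℕ} {S : Type*}

/-- The hypotheses on the dual pair of problems; `lam` plays the role of `λ_max(AᵀA)`. -/
structure IsDualSetting (f : Vec n → ℝ) (A : Vec n →L[ℝ] Vec m) (μ lam L : ℝ) (ys : Vec m) :
    Prop where
  convex : IsStrongConvexWithSubgradient f μ
  lam_pos : 0 < lam
  norm_apply_le : ∀ v, ‖A v‖ ≤ √lam * ‖v‖
  norm_tr_apply_le : ∀ y, ‖tr A y‖ ≤ √lam * ‖y‖
  L_eq : L = 2 * (lam / μ)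
  isMinOn : IsMinOn (dualPsi f A) Set.univ ys

theorem IsDualSetting.L_pos {f : Vec n → ℝ} {A : Vec n →L[ℝ] Vec m} {μ lam L : ℝ} {ys : Vec m}
    (h : IsDualSetting f A μ lam L ys) : 0 < L := by
  have := h.convex.pos
  have := h.lam_pos
  rw [h.L_eq]; positivity

variable (f : Vec n → ℝ) (A : Vec n →L[ℝ] Vec m) (L : ℝ) (xt : Vec n → S → Vec n) (r : ℕ → ℕ)
  (s : ℕ → ℕ → S)

/-- The pair `(y^k, z^k)` along the sample path `s`. -/
def pathState (k : ℕ) : Vec m × Vec m := spdstmState L (fun k => batchGrad A xt (r k) (s k)) k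

/-- The exact maximizer at the query point of iteration `k`. -/
def pathArg (k : ℕ) : Vec n := argDual f (tr A (spdstmQuery L A xt r s k))

/-- The error of the batched oracle in iteration `k`. -/
def pathError (k : ℕ) : Vec n :=
  batchX xt (r k) (s k) (tr A (spdstmQuery L A xt r s k)) - pathArg f A L xt r s k

/-- `∑_{j < k} α_{j+1} e_j`, where `e_j` is the error of iteration `j`. -/
def errorSum (k : ℕ) : Vec n := ∑ j ∈ Finset.range k, stepSucc L j • pathError f A L xt r s j

/-- An upper bound for `‖z^k - y^*‖² / 2` in terms of the errors. -/
def distBound (lam : ℝ) (ys : Vec m) (k : ℕ) : ℝ :=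
  ‖ys‖ ^ 2 / 2 + ∑ j ∈ Finset.range k,
    (stepSucc L j * inner ℝ (A (pathError f A L xt r s j)) (ys - (pathState A L xt r s j).2) +
      stepSucc L j ^ 2 * (lam * ‖pathError f A L xt r s j‖ ^ 2))

/-- The potential whose exponential moments are controlled. -/
def errorPotential (lam τ : ℝ) (ys : Vec m) (k : ℕ) : ℝ :=
  distBound f A L xt r s lam ys k + τ * lam * ‖errorSum f A L xt r s k‖ ^ 2

/-- The direction that is paired with the error of iteration `k` in the potential. -/
def errorDirection (lam τ : ℝ) (ys : Vec m) (k : ℕ) : Vec n :=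
  tr A (ys - (pathState A L xt r s k).2) + (2 * τ * lam) • errorSum f A L xt r s k

variable {f A L xt r s} {μ lam τ : ℝ} {ys : Vec m}

theorem batchGrad_sub_eq (k : ℕ) :
    batchGrad A xt (r k) (s k) (midPoint L k (pathState A L xt r s k)) -
      A (pathArg f A L xt r s k) = A (pathError f A L xt r s k) := (map_sub A _ _).symm

theorem errorPotential_zero :
    errorPotential f A L xt r s lam τ ys 0 = ‖ys‖ ^ 2 / 2 := by
  simp [errorPotential, distBound, errorSum]

theorem errorPotential_succ (k : ℕ) :
    errorPotential f A L xt r s lam τ ys (k + 1) = errorPotential f A L xt r s lam τ ys k +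
      stepSucc L k * inner ℝ (errorDirection f A L xt r s lam τ ys k) (pathError f A L xt r s k) +
      (1 + τ) * stepSucc L k ^ 2 * lam * ‖pathError f A L xt r s k‖ ^ 2 := by
  have e : errorSum f A L xt r s (k + 1) =
      errorSum f A L xt r s k + stepSucc L k • pathError f A L xt r s k :=
    Finset.sum_range_succ _ _
  rw [errorPotential, errorPotential, e, distBound, distBound, Finset.sum_range_succ,
    errorDirection, norm_add_sq_real, inner_add_left, ContinuousLinearMap.adjoint_inner_left,
    real_inner_smul_left, real_inner_smul_right, norm_smul, mul_pow, Real.norm_eq_abs, sq_abs,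
    real_inner_comm (A _)]
  ring

variable (h : IsDualSetting f A μ lam L ys)
include h

theorem sq_norm_apply_le_of_isDualSetting (v : Vec n) : ‖A v‖ ^ 2 ≤ lam * ‖v‖ ^ 2 := by
  have := pow_le_pow_left₀ (norm_nonneg _) (h.norm_apply_le v) 2
  rwa [mul_pow, Real.sq_sqrt h.lam_pos.le] at this

theorem sq_norm_tr_apply_le_of_isDualSetting (y : Vec m) : ‖tr A y‖ ^ 2 ≤ lam * ‖y‖ ^ 2 := by
  have := pow_le_pow_left₀ (norm_nonneg _) (h.norm_tr_apply_le y) 2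
  rwa [mul_pow, Real.sq_sqrt h.lam_pos.le] at this

theorem pathState_step (k : ℕ) (u : Vec m) :
    accA L (k + 1) * dualPsi f A (pathState A L xt r s (k + 1)).1 +
        ‖(pathState A L xt r s (k + 1)).2 - u‖ ^ 2 / 2 ≤
      accA L k * dualPsi f A (pathState A L xt r s k).1 +
        ‖(pathState A L xt r s k).2 - u‖ ^ 2 / 2 +
      stepSucc L k * (dualPsi f A (spdstmQuery L A xt r s k) +
        inner ℝ (A (pathArg f A L xt r s k)) (u - spdstmQuery L A xt r s k)) +
      (stepSucc L k * inner ℝ (A (pathError f A L xt r s k)) (u - (pathState A L xt r s k).2) +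
        stepSucc L k ^ 2 * (lam * ‖pathError f A L xt r s k‖ ^ 2)) := by
  have h1 := spdstm_step h.convex h.lam_pos h.norm_tr_apply_le h.L_eq
    (fun k => batchGrad A xt (r k) (s k)) k u (x := pathArg f A L xt r s k) rfl
    (batchGrad_sub_eq k).symm
  have h2 := mul_le_mul_of_nonneg_left
    (sq_norm_apply_le_of_isDualSetting h (pathError f A L xt r s k)) (sq_nonneg (stepSucc L k))
  change _ ≤ accA L k * dualPsi f A (pathState A L xt r s k).1 + _ + stepSucc L k *
    (dualPsi f A (spdstmQuery L A xt r s k) + inner ℝ _ (u - spdstmQuery L A xt r s k)) + _ at h1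
  change _ ≤ _ + ‖(pathState A L xt r s k).2 - u‖ ^ 2 / 2 + _ +
    (_ * inner ℝ _ (u - (pathState A L xt r s k).2) + _) at h1
  exact h1.trans (by linarith)

/-- The step inequality is telescoped with `u = y^*`, where convexity bounds the linear model by
`ψ(y^*)`; the term `A_k (ψ(y^k) - ψ(y^*)) ≥ 0` is then dropped. -/
theorem half_sq_norm_sub_le_distBound (k : ℕ) :
    ‖(pathState A L xt r s k).2 - ys‖ ^ 2 / 2 ≤ distBound f A L xt r s lam ys k := by
  have key : accA L k * (dualPsi f A (pathState A L xt r s k).1 - dualPsi f A ys) +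
      ‖(pathState A L xt r s k).2 - ys‖ ^ 2 / 2 ≤ distBound f A L xt r s lam ys k := by
    induction k with
    | zero => simp [accA, pathState, spdstmState, distBound]
    | succ k ih =>
      have h1 := pathState_step h (xt := xt) (r := r) (s := s) k ys
      have h2 := h.convex.dualPsi_add_inner_le A (spdstmQuery L A xt r s k) ys
      have h3 := mul_le_mul_of_nonneg_left h2 (stepSucc_pos h.L_pos k).le
      have h4 := accA_succ L k
      rw [distBound, Finset.sum_range_succ, ← add_assoc]
      rw [distBound] at ih
      change stepSucc L k * (_ + inner ℝ (A (pathArg f A L xt r s k)) _) ≤ _ at h3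
      have h5 : accA L (k + 1) * dualPsi f A ys =
        accA L k * dualPsi f A ys + stepSucc L k * dualPsi f A ys := by rw [h4]; ring
      linarith
  have := mul_nonneg (accA_nonneg h.L_pos k)
    (sub_nonneg.2 (h.isMinOn (Set.mem_univ (pathState A L xt r s k).1)))
  linarith

/-- The step inequality is telescoped with `u = 0`, where the linear model of `ψ` at the query point
equals `-f` at the exact maximizer. The error terms are those of `distBound`, except that `y^*` is
missing from the inner products; the last term corrects for it. -/
theorem accA_mul_dualPsi_add_sum_le (k : ℕ) :
    accA L k * dualPsi f A (pathState A L xt r s k).1 +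
        ∑ j ∈ Finset.range k, stepSucc L j * f (pathArg f A L xt r s j) ≤
      distBound f A L xt r s lam ys k - ‖ys‖ ^ 2 / 2 -
        inner ℝ (A (errorSum f A L xt r s k)) ys := by
  have key : accA L k * dualPsi f A (pathState A L xt r s k).1 +
        ‖(pathState A L xt r s k).2 - 0‖ ^ 2 / 2 +
        ∑ j ∈ Finset.range k, stepSucc L j * f (pathArg f A L xt r s j) ≤
      ∑ j ∈ Finset.range k,
        (stepSucc L j * inner ℝ (A (pathError f A L xt r s j)) (0 - (pathState A L xt r s j).2) +
          stepSucc L j ^ 2 * (lam * ‖pathError f A L xt r s j‖ ^ 2)) := by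
    induction k with
    | zero => simp [accA, pathState, spdstmState]
    | succ k ih =>
      have h1 := pathState_step h (xt := xt) (r := r) (s := s) k 0
      have h2 := h.convex.dualPsi_eq A (spdstmQuery L A xt r s k) 0
      rw [inner_zero_right, zero_sub (f _)] at h2
      change _ + inner ℝ (A (pathArg f A L xt r s k)) _ = -f (pathArg f A L xt r s k) at h2
      rw [h2] at h1
      rw [Finset.sum_range_succ, Finset.sum_range_succ]
      linarith
  have e : ∑ j ∈ Finset.range k,
        (stepSucc L j * inner ℝ (A (pathError f A L xt r s j)) (0 - (pathState A L xt r s j).2) +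
          stepSucc L j ^ 2 * (lam * ‖pathError f A L xt r s j‖ ^ 2)) =
      distBound f A L xt r s lam ys k - ‖ys‖ ^ 2 / 2 -
        inner ℝ (A (errorSum f A L xt r s k)) ys := by
    rw [distBound, errorSum, map_sum, sum_inner, add_sub_cancel_left, ← Finset.sum_sub_distrib]
    refine Finset.sum_congr rfl fun j _ => ?_
    rw [map_smul, real_inner_smul_left, inner_sub_right, inner_sub_right, inner_zero_right]
    ring
  rw [← e]
  have := sq_nonneg ‖(pathState A L xt r s k).2 - 0‖
  linarith

/-- The first part of the direction is controlled by `‖z^k - y^*‖² ≤ 2 D_k`, the second by the term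
`τ λ ‖E_k‖²` built into the potential. This self-bounding estimate closes the recursion for the
moments. -/
theorem sq_norm_errorDirection_le (hτ : 1 ≤ τ) (k : ℕ) :
    ‖errorDirection f A L xt r s lam τ ys k‖ ^ 2 ≤
      8 * τ * lam * errorPotential f A L xt r s lam τ ys k := by
  have hl := h.lam_pos
  have h1 := half_sq_norm_sub_le_distBound h (xt := xt) (r := r) (s := s) k
  have h2 := sq_norm_tr_apply_le_of_isDualSetting h (ys - (pathState A L xt r s k).2)
  rw [norm_sub_rev ys] at h2
  rw [errorDirection, errorPotential]
  set a := tr A (ys - (pathState A L xt r s k).2)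
  set D := distBound f A L xt r s lam ys k
  set U := ‖errorSum f A L xt r s k‖ ^ 2 with hU
  have h3 : ‖(2 * τ * lam) • errorSum f A L xt r s k‖ ^ 2 = 4 * τ ^ 2 * lam ^ 2 * U := by
    rw [norm_smul, mul_pow, Real.norm_eq_abs, sq_abs, hU]; ring
  have h4 := norm_add_le a ((2 * τ * lam) • errorSum f A L xt r s k)
  have h5 := pow_le_pow_left₀ (norm_nonneg _) h4 2
  have h6 := add_sq_le (a := ‖a‖) (b := ‖(2 * τ * lam) • errorSum f A L xt r s k‖)
  have hD : 0 ≤ D := le_trans (by positivity) h1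
  have h7 : ‖a‖ ^ 2 ≤ 2 * lam * D := by nlinarith
  have h8 : lam * D ≤ τ * (lam * D) := le_mul_of_one_le_left (by positivity) hτ
  have h9 : 0 ≤ lam * D := by positivity
  rw [h3] at h6
  nlinarith

theorem errorPotential_nonneg (hτ : 0 ≤ τ) (k : ℕ) :
    0 ≤ errorPotential f A L xt r s lam τ ys k := by
  have hl := h.lam_pos
  have h1 := half_sq_norm_sub_le_distBound h (xt := xt) (r := r) (s := s) k
  have h2 : 0 ≤ ‖(pathState A L xt r s k).2 - ys‖ ^ 2 / 2 := by positivity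
  have h3 : 0 ≤ τ * lam * ‖errorSum f A L xt r s k‖ ^ 2 := by positivity
  rw [errorPotential]; linarith

end ErrorProcess

/-! ### Measurability of the iterates with respect to past batches. -/

section Measurability

variable {n m : ℕ} {S : Type*} [MeasurableSpace S] {f : Vec n → ℝ} {A : Vec n →L[ℝ] Vec m}
  {μ lam τ L : ℝ} {ys : Vec m} {xt : Vec n → S → Vec n} {r : ℕ → ℕ}

theorem measurable_batchX (hxt : Measurable (Function.uncurry xt)) (r : ℕ) :
    Measurable fun p : Vec n × (ℕ → S) => batchX xt r p.2 p.1 := by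
  unfold batchX
  have h : ∀ l, Measurable fun p : Vec n × (ℕ → S) => xt p.1 (p.2 l) := fun l =>
    hxt.comp (measurable_fst.prodMk ((measurable_pi_apply l).comp measurable_snd))
  fun_prop

theorem measurable_batchGrad (hxt : Measurable (Function.uncurry xt)) (r : ℕ) :
    Measurable fun p : Vec m × (ℕ → S) => batchGrad A xt r p.2 p.1 := by
  have h1 : Measurable fun p : Vec m × (ℕ → S) => (tr A p.1, p.2) := by fun_prop
  have h2 := (measurable_batchX hxt r).comp h1
  unfold batchGrad
  exact A.measurable.comp h2

variable {Ω : Type*} [MeasurableSpace Ω] {ξ : ℕ → ℕ → Ω → S}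

/-- The update of `(y^k, z^k)` with the stochastic gradient `g`. -/
noncomputable def spdstmUpdate (L : ℝ) (k : ℕ) (w : Vec m × Vec m) (g : Vec m) :
    Vec m × Vec m :=
  ((accA L (k + 1))⁻¹ • (accA L k • w.1 + stepSucc L k • (w.2 - stepSucc L k • g)),
    w.2 - stepSucc L k • g)

/-- Only the batches `j < k` are assumed measurable, and the σ-algebra on `Ω` is arbitrary. It can
therefore be taken to be the one generated by the past, which yields independence of batch `k`. -/
theorem measurable_pathState (hxt : Measurable (Function.uncurry xt)) {k : ℕ}
    (hξ : ∀ j < k, ∀ l, Measurable (ξ j l)) :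
    Measurable fun ω => pathState A L xt r (fun j l => ξ j l ω) k := by
  induction k with
  | zero => exact measurable_const
  | succ k ih =>
    have h1 := ih fun j hj => hξ j (by omega)
    have h2 : Measurable fun ω => midPoint L k (pathState A L xt r (fun j l => ξ j l ω) k) := by
      unfold midPoint; fun_prop
    have h3 : Measurable fun ω => fun l => ξ k l ω := measurable_pi_lambda _ (hξ k (by omega))
    have h4 := (measurable_batchGrad (A := A) hxt (r k)).comp (h2.prodMk h3)
    simp only [Function.comp_def] at h4
    have e : ∀ ω, pathState A L xt r (fun j l => ξ j l ω) (k + 1) = spdstmUpdate L k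
        (pathState A L xt r (fun j l => ξ j l ω) k) (batchGrad A xt (r k) (fun l => ξ k l ω)
          (midPoint L k (pathState A L xt r (fun j l => ξ j l ω) k))) := fun ω => rfl
    simp_rw [e]
    unfold spdstmUpdate
    fun_prop

theorem measurable_spdstmQuery (hxt : Measurable (Function.uncurry xt)) {k : ℕ}
    (hξ : ∀ j < k, ∀ l, Measurable (ξ j l)) :
    Measurable fun ω => spdstmQuery L A xt r (fun j l => ξ j l ω) k := by
  have h1 := measurable_pathState (A := A) (L := L) (r := r) hxt hξ
  change Measurable fun ω => midPoint L k (pathState A L xt r (fun j l => ξ j l ω) k)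
  unfold midPoint; fun_prop

theorem measurable_pathError (hf : IsStrongConvexWithSubgradient f μ)
    (hxt : Measurable (Function.uncurry xt)) {k : ℕ}
    (hξ : ∀ j ≤ k, ∀ l, Measurable (ξ j l)) :
    Measurable fun ω => pathError f A L xt r (fun j l => ξ j l ω) k := by
  have h1 := (tr A).measurable.comp
    (measurable_spdstmQuery (A := A) (L := L) (r := r) hxt fun j hj => hξ j (le_of_lt hj))
  have h3 : Measurable fun ω => fun l => ξ k l ω := measurable_pi_lambda _ (hξ k le_rfl)
  exact ((measurable_batchX hxt (r k)).comp (h1.prodMk h3)).sub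
    (hf.continuous_argDual.measurable.comp h1)

theorem measurable_errorSum (hf : IsStrongConvexWithSubgradient f μ)
    (hxt : Measurable (Function.uncurry xt)) {k : ℕ}
    (hξ : ∀ j < k, ∀ l, Measurable (ξ j l)) :
    Measurable fun ω => errorSum f A L xt r (fun j l => ξ j l ω) k :=
  Finset.measurable_sum _ fun _ hj => (measurable_pathError hf hxt fun i hi =>
    hξ i (lt_of_le_of_lt hi (Finset.mem_range.1 hj))).fun_const_smul _

theorem measurable_errorPotential (hf : IsStrongConvexWithSubgradient f μ)
    (hxt : Measurable (Function.uncurry xt)) {k : ℕ}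
    (hξ : ∀ j < k, ∀ l, Measurable (ξ j l)) :
    Measurable fun ω => errorPotential f A L xt r (fun j l => ξ j l ω) lam τ ys k := by
  have h1 : Measurable fun ω => distBound f A L xt r (fun j l => ξ j l ω) lam ys k := by
    refine Measurable.const_add (Finset.measurable_sum _ fun j hj => ?_) _
    have hj' := Finset.mem_range.1 hj
    have h2 := measurable_pathError (A := A) (L := L) (r := r) hf hxt fun i hi =>
      hξ i (lt_of_le_of_lt hi hj')
    have h3 := measurable_pathState (A := A) (L := L) (r := r) hxt fun i hi =>
      hξ i (lt_trans hi hj')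
    have h4 := A.measurable.comp h2
    exact ((h4.inner (h3.snd.const_sub _)).const_mul _).add
      (((h2.norm.pow_const 2).const_mul _).const_mul _)
  exact h1.add (((measurable_errorSum hf hxt hξ).norm.pow_const 2).const_mul _)

theorem measurable_errorDirection (hf : IsStrongConvexWithSubgradient f μ)
    (hxt : Measurable (Function.uncurry xt)) {k : ℕ}
    (hξ : ∀ j < k, ∀ l, Measurable (ξ j l)) :
    Measurable fun ω => errorDirection f A L xt r (fun j l => ξ j l ω) lam τ ys k :=
  ((tr A).measurable.comp ((measurable_pathState hxt hξ).snd.const_sub _)).add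
    ((measurable_errorSum hf hxt hξ).fun_const_smul _)

end Measurability

/-! ### One-step recursion for the exponential moments of the potential. -/

section Moments

variable {n m : ℕ} {S Ω : Type*} [MeasurableSpace S] [mΩ : MeasurableSpace Ω]
  {f : Vec n → ℝ} {A : Vec n →L[ℝ] Vec m} {μ lam τ L δ σ : ℝ} {ys : Vec m}
  {ν : Measure S} {xt : Vec n → S → Vec n} {r : ℕ → ℕ} {P : Measure Ω} [IsProbabilityMeasure P]
  {ξ : ℕ → ℕ → Ω → S}

/-- An array of independent samples with law `ν`. -/
structure IsSampleArray (P : Measure Ω) (ν : Measure S) (ξ : ℕ → ℕ → Ω → S) : Prop where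
  measurable : ∀ k l, Measurable (ξ k l)
  map_eq : ∀ k l, P.map (ξ k l) = ν
  indep : iIndepFun (fun p : ℕ × ℕ => ξ p.1 p.2) P

theorem IsBiasedOracle.bias_nonneg (ho : IsBiasedOracle f ν xt δ σ) : 0 ≤ δ :=
  (norm_nonneg _).trans (ho.bias 0)

omit [IsProbabilityMeasure P] in
theorem IsBiasedOracle.isLightTailed [IsProbabilityMeasure ν] (ho : IsBiasedOracle f ν xt δ σ)
    (hξ : IsSampleArray P ν ξ) (u : Vec n) (k l : ℕ) :
    IsLightTailed P (fun ω => xt u (ξ k l ω) - ∫ s, xt u s ∂ν) σ := by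
  have hm : Measurable (xt u) := ho.measurable.of_uncurry_left
  have hi : Integrable (fun s => xt u s - ∫ s, xt u s ∂ν) ν :=
    (ho.integrable u).sub (integrable_const _)
  have hmap := hξ.map_eq k l
  refine ⟨(hm.comp (hξ.measurable k l)).sub_const _, ?_, ?_, ?_⟩
  · rw [← hmap] at hi
    have := hi.comp_measurable (hξ.measurable k l)
    rw [hmap] at this
    exact this
  · have h1 : ∫ ω, (xt u (ξ k l ω) - ∫ s, xt u s ∂ν) ∂P =
        ∫ s, (xt u s - ∫ s, xt u s ∂ν) ∂(P.map (ξ k l)) :=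
      (integral_map (hξ.measurable k l).aemeasurable
        (hm.sub_const _).aestronglyMeasurable).symm
    rw [h1, hmap, integral_sub (ho.integrable u) (integrable_const _)]
    simp
  · have hm2 : Measurable fun s => ENNReal.ofReal (Real.exp
        (‖xt u s - ∫ s, xt u s ∂ν‖ ^ 2 / σ ^ 2)) := by fun_prop
    have h1 : ∫⁻ ω, ENNReal.ofReal (Real.exp
          (‖xt u (ξ k l ω) - ∫ s, xt u s ∂ν‖ ^ 2 / σ ^ 2)) ∂P =
        ∫⁻ s, ENNReal.ofReal (Real.exp
          (‖xt u s - ∫ s, xt u s ∂ν‖ ^ 2 / σ ^ 2)) ∂(P.map (ξ k l)) :=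
      (lintegral_map hm2 (hξ.measurable k l)).symm
    rw [h1, hmap]
    exact ho.lightTails u

/-- The error is a centered average plus a bias of norm at most `δ`. Splitting the square by `‖T +
b‖² ≤ 2‖T‖² + 2δ²` doubles `c`. -/
theorem lintegral_exp_batch_error_le [IsProbabilityMeasure ν] (ho : IsBiasedOracle f ν xt δ σ)
    (hξ : IsSampleArray P ν ξ) (hσ : 0 < σ) (k : ℕ) (u v : Vec n) {b : ℕ} (hb : 0 < b) {c : ℝ}
    (hc : 0 < c) (hc1 : 32 * c * (σ ^ 2 / b) ≤ 1) :
    ∫⁻ ω, ENNReal.ofReal (Real.exp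
        (inner ℝ v (batchX xt b (fun l => ξ k l ω) u - argDual f u) +
          c * ‖batchX xt b (fun l => ξ k l ω) u - argDual f u‖ ^ 2)) ∂P ≤
      ENNReal.ofReal (Real.exp (δ * ‖v‖ + 2 * c * δ ^ 2 +
        (4 * (σ ^ 2 / b) * ‖v‖ ^ 2 + 4 * c * (σ ^ 2 / b)))) := by
  set M := ∫ s, xt u s ∂ν with hM
  have hind : iIndepFun (fun l ω => xt u (ξ k l ω) - M) P := by
    have h1 := hξ.indep.precomp (g := fun l : ℕ => (k, l)) (fun a b hab => by simpa using hab)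
    exact h1.comp (fun _ s => xt u s - M) fun _ => ho.measurable.of_uncurry_left.sub_const _
  have h := lintegral_exp_inner_average_le (ho.isLightTailed hξ u k) hind hσ v hb
    (c := 2 * c) (by positivity) (by linarith)
  have hb' : (b : ℝ) ≠ 0 := by exact_mod_cast hb.ne'
  have e : ∀ ω, batchX xt b (fun l => ξ k l ω) u - argDual f u =
      (b : ℝ)⁻¹ • ∑ i ∈ Finset.range b, (xt u (ξ k i ω) - M) + (M - argDual f u) := fun ω => by
    rw [batchX, Finset.sum_sub_distrib, smul_sub, Finset.sum_const, Finset.card_range,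
      ← Nat.cast_smul_eq_nsmul ℝ, smul_smul, inv_mul_cancel₀ hb', one_smul]
    abel
  have hbias : ‖M - argDual f u‖ ≤ δ := ho.bias u
  have hδ := ho.bias_nonneg
  calc _ ≤ ∫⁻ ω, ENNReal.ofReal (Real.exp (δ * ‖v‖ + 2 * c * δ ^ 2)) * ENNReal.ofReal (Real.exp
          (inner ℝ v ((b : ℝ)⁻¹ • ∑ i ∈ Finset.range b, (xt u (ξ k i ω) - M)) +
            2 * c * ‖(b : ℝ)⁻¹ • ∑ i ∈ Finset.range b, (xt u (ξ k i ω) - M)‖ ^ 2)) ∂P := by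
        refine lintegral_mono fun ω => ?_
        rw [← ENNReal.ofReal_mul (Real.exp_pos _).le, ← Real.exp_add, e]
        refine ENNReal.ofReal_le_ofReal (Real.exp_le_exp.2 ?_)
        set T := (b : ℝ)⁻¹ • ∑ i ∈ Finset.range b, (xt u (ξ k i ω) - M)
        have h1 := real_inner_le_norm v (M - argDual f u)
        have h2 : ‖v‖ * ‖M - argDual f u‖ ≤ δ * ‖v‖ := by
          rw [mul_comm]; gcongr
        have h3 : ‖T + (M - argDual f u)‖ ^ 2 ≤ 2 * ‖T‖ ^ 2 + 2 * δ ^ 2 := by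
          have h4 := pow_le_pow_left₀ (norm_nonneg _) (norm_add_le T (M - argDual f u)) 2
          have h5 := add_sq_le (a := ‖T‖) (b := ‖M - argDual f u‖)
          have h6 := pow_le_pow_left₀ (norm_nonneg _) hbias 2
          linarith
        have h4 := mul_le_mul_of_nonneg_left h3 hc.le
        rw [inner_add_right]
        linarith
    _ ≤ ENNReal.ofReal (Real.exp (δ * ‖v‖ + 2 * c * δ ^ 2)) * ENNReal.ofReal (Real.exp
          (4 * (σ ^ 2 / b) * ‖v‖ ^ 2 + 2 * (2 * c) * (σ ^ 2 / b))) := by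
        rw [lintegral_const_mul' _ _ ENNReal.ofReal_ne_top]
        gcongr
    _ = _ := by
        rw [← ENNReal.ofReal_mul (Real.exp_pos _).le, ← Real.exp_add]
        congr 3; ring

omit [IsProbabilityMeasure P] in
/-- Anything that depends only on the first `k` batches is independent of batch `k`. -/
theorem IsSampleArray.indepFun_of_measurable (hξ : IsSampleArray P ν ξ) {β : Type*}
    [mβ : MeasurableSpace β] {k : ℕ} {X : Ω → β}
    (hX : ∀ m' : MeasurableSpace Ω, (∀ j < k, ∀ l, Measurable[m'] (ξ j l)) → Measurable[m'] X) :
    IndepFun X (fun ω l => ξ k l ω) P := by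
  have hle : ∀ p : ℕ × ℕ, MeasurableSpace.comap (ξ p.1 p.2) inferInstance ≤ mΩ :=
    fun p => (hξ.measurable p.1 p.2).comap_le
  have h := indep_iSup_of_disjoint hle ((iIndepFun_iff_iIndep _ _ _).1 hξ.indep)
    (S := {p | p.1 < k}) (T := {p | p.1 = k})
    (Set.disjoint_left.2 fun p (h1 : p.1 < k) (h2 : p.1 = k) => by omega)
  rw [IndepFun_iff_Indep]
  refine indep_of_indep_of_le_left (indep_of_indep_of_le_right h ?_) ?_
  · refine Measurable.comap_le (@measurable_pi_lambda _ _ _ (_) _ _ fun l => ?_)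
    refine Measurable.of_comap_le ?_
    exact le_iSup₂_of_le (f := fun (p : ℕ × ℕ) (_ : p ∈ {p : ℕ × ℕ | p.1 = k}) =>
      MeasurableSpace.comap (ξ p.1 p.2) inferInstance) (k, l) rfl le_rfl
  · refine Measurable.comap_le (hX _ fun j hj l => Measurable.of_comap_le ?_)
    exact le_iSup₂_of_le (f := fun (p : ℕ × ℕ) (_ : p ∈ {p : ℕ × ℕ | p.1 < k}) =>
      MeasurableSpace.comap (ξ p.1 p.2) inferInstance) (j, l) hj le_rfl

variable [IsProbabilityMeasure ν]

/-- The batch is integrated out with the past frozen. The four terms of `ρ` pay for the bias in the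
linear term, the squared bias, the variance of the linear term, and the squared noise. Adding `R²`
to the potential lets the terms without a factor `Φ` be absorbed multiplicatively too. -/
theorem lintegral_exp_errorPotential_succ_le (h : IsDualSetting f A μ lam L ys)
    (ho : IsBiasedOracle f ν xt δ σ) (hξ : IsSampleArray P ν ξ) (hσ : 0 < σ) (hτ : 1 ≤ τ)
    {k : ℕ} (hr : 0 < r k) {θ θ₀ R : ℝ} (hθ : 0 < θ) (hθ₀ : θ ≤ 2 * θ₀) (hR : 0 < R) {d v ρ : ℝ}
    (hd : d = stepSucc L k * (√lam * δ)) (hv : v = stepSucc L k ^ 2 * (lam * σ ^ 2 / r k))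
    (hsmall : 128 * τ * (θ₀ * v) ≤ 1)
    (hρ : ρ = 2 * τ * (d / R) + 4 * τ * (d / R) ^ 2 + 64 * τ * (θ₀ * v) + 8 * τ * (v / R ^ 2)) :
    ∫⁻ ω, ENNReal.ofReal (Real.exp (θ *
        (errorPotential f A L xt r (fun j l => ξ j l ω) lam τ ys (k + 1) + R ^ 2))) ∂P ≤
      ∫⁻ ω, ENNReal.ofReal (Real.exp (θ * (1 + ρ) *
        (errorPotential f A L xt r (fun j l => ξ j l ω) lam τ ys k + R ^ 2))) ∂P := by
  have hl := h.lam_pos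
  have hα := stepSucc_pos h.L_pos k
  have hδ := ho.bias_nonneg
  have hr' : (0 : ℝ) < r k := by exact_mod_cast hr
  have hv0 : 0 < v := by rw [hv]; positivity
  have hd0 : 0 ≤ d := by rw [hd]; positivity
  set α := stepSucc L k with hαdef
  -- The potential, the direction and the query are all that step `k` needs from the past.
  let X : Ω → ℝ × Vec n × Vec n := fun ω =>
    (errorPotential f A L xt r (fun j l => ξ j l ω) lam τ ys k,
      errorDirection f A L xt r (fun j l => ξ j l ω) lam τ ys k,
      tr A (spdstmQuery L A xt r (fun j l => ξ j l ω) k))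
  have hX : ∀ m' : MeasurableSpace Ω, (∀ j < k, ∀ l, Measurable[m'] (ξ j l)) →
      Measurable[m'] X := fun m' hm' =>
    (measurable_errorPotential h.convex ho.measurable hm').prodMk
      ((measurable_errorDirection h.convex ho.measurable hm').prodMk
        ((tr A).measurable.comp (measurable_spdstmQuery ho.measurable hm')))
  have hB : Measurable fun p : (ℝ × Vec n × Vec n) × (ℕ → S) =>
      batchX xt (r k) p.2 p.1.2.2 - argDual f p.1.2.2 := by
    have h1 : Measurable fun p : (ℝ × Vec n × Vec n) × (ℕ → S) => (p.1.2.2, p.2) := by fun_prop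
    exact ((measurable_batchX ho.measurable (r k)).comp h1).sub
      (h.convex.continuous_argDual.measurable.comp h1.fst)
  let g : (ℝ × Vec n × Vec n) × (ℕ → S) → ENNReal := fun p =>
    ENNReal.ofReal (Real.exp (θ * (p.1.1 + R ^ 2))) * ENNReal.ofReal (Real.exp
      (inner ℝ ((θ * α) • p.1.2.1) (batchX xt (r k) p.2 p.1.2.2 - argDual f p.1.2.2) +
        θ * ((1 + τ) * α ^ 2 * lam) * ‖batchX xt (r k) p.2 p.1.2.2 - argDual f p.1.2.2‖ ^ 2))
  have hg : Measurable g := by fun_prop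
  have hdec := lintegral_comp_prodMk_eq_of_indepFun (hξ.indepFun_of_measurable hX)
    (hX _ fun j _ => hξ.measurable j) (measurable_pi_lambda _ (hξ.measurable k)) hg
  have e : ∀ ω, ENNReal.ofReal (Real.exp (θ *
      (errorPotential f A L xt r (fun j l => ξ j l ω) lam τ ys (k + 1) + R ^ 2))) =
      g (X ω, fun l => ξ k l ω) := fun ω => by
    simp only [g, X]
    rw [← ENNReal.ofReal_mul (Real.exp_pos _).le, ← Real.exp_add, errorPotential_succ,
      real_inner_smul_left]
    congr 2
    simp only [pathError, pathArg, hαdef]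
    ring
  simp_rw [e]
  rw [hdec]
  refine lintegral_mono fun ω => ?_
  simp only [g]
  rw [lintegral_const_mul' _ _ ENNReal.ofReal_ne_top]
  have hcs : θ * ((1 + τ) * α ^ 2 * lam) * (σ ^ 2 / r k) = θ * (1 + τ) * v := by rw [hv]; ring
  have hθv : θ * v ≤ 2 * (θ₀ * v) := by nlinarith
  have hτv : (1 + τ) * (θ * v) ≤ 2 * τ * (θ * v) := by
    have : 0 < θ * v := by positivity
    nlinarith
  have hτv2 : 2 * τ * (θ * v) ≤ 2 * τ * (2 * (θ₀ * v)) := by gcongr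
  have hone := lintegral_exp_batch_error_le ho hξ hσ k (X ω).2.2 ((θ * α) • (X ω).2.1) hr
    (c := θ * ((1 + τ) * α ^ 2 * lam)) (by positivity) (by rw [mul_assoc, hcs]; linarith)
  refine (mul_le_mul_right hone _).trans ?_
  rw [← ENNReal.ofReal_mul (Real.exp_pos _).le, ← Real.exp_add]
  refine ENNReal.ofReal_le_ofReal (Real.exp_le_exp.2 ?_)
  have hw := sq_norm_errorDirection_le h hτ (xt := xt) (r := r) (s := fun j l => ξ j l ω) k
  have hΦ := errorPotential_nonneg h (by linarith : 0 ≤ τ) (xt := xt) (r := r)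
    (s := fun j l => ξ j l ω) k
  simp only [X]
  set Φ := errorPotential f A L xt r (fun j l => ξ j l ω) lam τ ys k
  set w := errorDirection f A L xt r (fun j l => ξ j l ω) lam τ ys k
  have hnorm : ‖(θ * α) • w‖ = θ * α * ‖w‖ := by
    rw [norm_smul, Real.norm_eq_abs, abs_of_pos (by positivity)]
  have hl2 : √lam ^ 2 = lam := Real.sq_sqrt hl.le
  have hsl : 0 < √lam := Real.sqrt_pos.2 hl
  -- The arithmetic–geometric mean inequality converts the square-root bound on `‖w‖` into one
  -- affine in `Φ`.
  have hwR : ‖w‖ * R ≤ √lam * (2 * τ * Φ + R ^ 2) := by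
    have h1 : 0 ≤ (‖w‖ - 2 * √lam * R) ^ 2 := sq_nonneg _
    have h2 : 4 * √lam * (‖w‖ * R) ≤ 4 * √lam * (√lam * (2 * τ * Φ + R ^ 2)) := by
      nlinarith
    exact le_of_mul_le_mul_left h2 (by positivity)
  have t1 : δ * ‖(θ * α) • w‖ ≤ θ * (2 * τ * (d / R)) * (Φ + R ^ 2) := by
    have h1 : δ * ‖(θ * α) • w‖ * R ≤ θ * d * (2 * τ * Φ + R ^ 2) := by
      rw [hnorm, hd]
      have := mul_le_mul_of_nonneg_left hwR (by positivity : 0 ≤ θ * α * δ)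
      linarith
    have h2 : θ * d * (2 * τ * Φ + R ^ 2) ≤ θ * d * (2 * τ * (Φ + R ^ 2)) := by
      gcongr
      nlinarith [sq_nonneg R]
    have h3 : θ * (2 * τ * (d / R)) * (Φ + R ^ 2) = θ * d * (2 * τ * (Φ + R ^ 2)) / R := by
      field_simp
    rw [h3, le_div_iff₀ hR]
    exact h1.trans h2
  have t2 : 2 * (θ * ((1 + τ) * α ^ 2 * lam)) * δ ^ 2 ≤
      θ * (4 * τ * (d / R) ^ 2) * (Φ + R ^ 2) := by
    have h1 : 2 * (θ * ((1 + τ) * α ^ 2 * lam)) * δ ^ 2 = θ * (2 * (1 + τ)) * d ^ 2 := by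
      rw [hd, mul_pow, mul_pow, hl2]; ring
    have h2 : θ * (4 * τ * (d / R) ^ 2) * (Φ + R ^ 2) =
      θ * (4 * τ) * d ^ 2 + θ * (4 * τ * (d / R) ^ 2) * Φ := by field_simp; ring
    have h3 : 0 ≤ θ * (4 * τ * (d / R) ^ 2) * Φ := by positivity
    have h4 : θ * (2 * (1 + τ)) * d ^ 2 ≤ θ * (4 * τ) * d ^ 2 :=
      mul_le_mul_of_nonneg_right (mul_le_mul_of_nonneg_left (by linarith) hθ.le) (sq_nonneg d)
    linarith
  have t3 : 4 * (σ ^ 2 / r k) * ‖(θ * α) • w‖ ^ 2 ≤ θ * (64 * τ * (θ₀ * v)) * (Φ + R ^ 2) := by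
    have h1 : 4 * (σ ^ 2 / r k) * ‖(θ * α) • w‖ ^ 2 =
      4 * (σ ^ 2 / r k) * (θ * α) ^ 2 * ‖w‖ ^ 2 := by rw [hnorm]; ring
    have h2 : 4 * (σ ^ 2 / r k) * (θ * α) ^ 2 * ‖w‖ ^ 2 ≤
      4 * (σ ^ 2 / r k) * (θ * α) ^ 2 * (8 * τ * lam * Φ) := by gcongr
    have h3 : 4 * (σ ^ 2 / r k) * (θ * α) ^ 2 * (8 * τ * lam * Φ) =
      θ * (32 * τ * (θ * v)) * Φ := by rw [hv]; ring
    have h4 : θ * (32 * τ * (θ * v)) * Φ ≤ θ * (32 * τ * (2 * (θ₀ * v))) * Φ := by gcongr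
    have h5 : 0 ≤ θ * (64 * τ * (θ₀ * v)) * R ^ 2 := by
      have : 0 < θ₀ := by linarith
      positivity
    linarith
  have t4 : 4 * (θ * ((1 + τ) * α ^ 2 * lam)) * (σ ^ 2 / r k) ≤
      θ * (8 * τ * (v / R ^ 2)) * (Φ + R ^ 2) := by
    have h1 : θ * (8 * τ * (v / R ^ 2)) * (Φ + R ^ 2) =
      8 * τ * (θ * v) + θ * (8 * τ * (v / R ^ 2)) * Φ := by field_simp; ring
    have h2 : 0 ≤ θ * (8 * τ * (v / R ^ 2)) * Φ := by positivity
    rw [mul_assoc, hcs]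
    linarith
  rw [hρ]
  linarith

end Moments

/-! ### A uniform high-probability bound on the potential. -/

section HighProbability

variable {n m : ℕ} {S Ω : Type*} [MeasurableSpace S] [MeasurableSpace Ω]
  {f : Vec n → ℝ} {A : Vec n →L[ℝ] Vec m} {μ lam τ L δ σ : ℝ} {ys : Vec m}
  {ν : Measure S} {xt : Vec n → S → Vec n} {r : ℕ → ℕ} {P : Measure Ω} [IsProbabilityMeasure P]
  {ξ : ℕ → ℕ → Ω → S} [IsProbabilityMeasure ν]

/-- Going back one step multiplies `θ` by `1 + ρ_k ≤ exp ρ_k`, hence the induction over all `θ`. At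
the start the potential is deterministic and, with `R²` added, at most `3/2 R²`. -/
theorem lintegral_exp_errorPotential_le (h : IsDualSetting f A μ lam L ys)
    (ho : IsBiasedOracle f ν xt δ σ) (hξ : IsSampleArray P ν ξ) (hσ : 0 < σ) (hτ : 1 ≤ τ)
    {N : ℕ} (hr : ∀ k < N, 0 < r k) {θ₀ R : ℝ} (hR : 0 < R) (hys : ‖ys‖ ≤ R) {d v ρ : ℕ → ℝ}
    (hd : ∀ k, d k = stepSucc L k * (√lam * δ))
    (hv : ∀ k, v k = stepSucc L k ^ 2 * (lam * σ ^ 2 / r k))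
    (hsmall : ∀ k < N, 128 * τ * (θ₀ * v k) ≤ 1)
    (hρ : ∀ k, ρ k = 2 * τ * (d k / R) + 4 * τ * (d k / R) ^ 2 + 64 * τ * (θ₀ * v k) +
      8 * τ * (v k / R ^ 2)) (hρ0 : ∀ k, 0 ≤ ρ k) {k : ℕ} (hk : k ≤ N) {θ : ℝ} (hθ : 0 < θ)
    (hθ₀ : θ * Real.exp (∑ j ∈ Finset.range k, ρ j) ≤ 2 * θ₀) :
    ∫⁻ ω, ENNReal.ofReal (Real.exp (θ *
        (errorPotential f A L xt r (fun j l => ξ j l ω) lam τ ys k + R ^ 2))) ∂P ≤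
      ENNReal.ofReal (Real.exp (θ * Real.exp (∑ j ∈ Finset.range k, ρ j) * (3 / 2 * R ^ 2))) := by
  induction k generalizing θ with
  | zero =>
    simp only [errorPotential_zero, lintegral_const, measure_univ, mul_one, Finset.range_zero,
      Finset.sum_empty, Real.exp_zero]
    refine ENNReal.ofReal_le_ofReal (Real.exp_le_exp.2 ?_)
    have := pow_le_pow_left₀ (norm_nonneg _) hys 2
    gcongr
    linarith
  | succ k ih =>
    rw [Finset.sum_range_succ, add_comm (∑ j ∈ _, _), Real.exp_add] at hθ₀ ⊢
    have h1 : 1 + ρ k ≤ Real.exp (ρ k) := by linarith [Real.add_one_le_exp (ρ k)]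
    have h2 : 1 ≤ Real.exp (∑ j ∈ Finset.range k, ρ j) :=
      Real.one_le_exp (Finset.sum_nonneg fun j _ => hρ0 j)
    have h3 : 0 < 1 + ρ k := by linarith [hρ0 k]
    have h4 : θ * (1 + ρ k) * Real.exp (∑ j ∈ Finset.range k, ρ j) ≤
        θ * (Real.exp (ρ k) * Real.exp (∑ j ∈ Finset.range k, ρ j)) := by
      rw [mul_assoc]; gcongr
    have h5 : θ ≤ θ * (Real.exp (ρ k) * Real.exp (∑ j ∈ Finset.range k, ρ j)) :=
      le_mul_of_one_le_right hθ.le (one_le_mul_of_one_le_of_one_le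
        (Real.one_le_exp (hρ0 k)) h2)
    refine (lintegral_exp_errorPotential_succ_le h ho hξ hσ hτ (hr k hk) hθ (h5.trans hθ₀) hR
      (hd k) (hv k) (hsmall k hk) (hρ k)).trans ?_
    refine (ih (by omega) (mul_pos hθ h3) (h4.trans hθ₀)).trans ?_
    refine ENNReal.ofReal_le_ofReal (Real.exp_le_exp.2 ?_)
    gcongr

theorem exp_half_le_two : Real.exp (1 / 2) ≤ 2 := by
  have h1 : Real.exp (1 / 2) ^ 2 = Real.exp 1 := by rw [← Real.exp_nat_mul]; norm_num
  have h2 := Real.exp_one_lt_d9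
  nlinarith [Real.exp_pos (1 / 2)]

theorem errorPotential_lt_with_high_probability (h : IsDualSetting f A μ lam L ys)
    (ho : IsBiasedOracle f ν xt δ σ) (hξ : IsSampleArray P ν ξ) (hσ : 0 < σ) (hτ : 1 ≤ τ)
    {N : ℕ} (hN : 1 ≤ N) (hr : ∀ k < N, 0 < r k) {β R : ℝ} (hR : 0 < R) (hys : ‖ys‖ ≤ R)
    (hβ : 0 < β) (hlog : 1 ≤ Real.log (N / β))
    (hbias : accA L N * (√lam * δ) ≤ R / (16 * τ))
    (hvar : Real.log (N / β) *
      ∑ k ∈ Finset.range N, stepSucc L k ^ 2 * (lam * σ ^ 2 / r k) ≤ R ^ 2 / (288 * τ)) :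
    ENNReal.ofReal (1 - β) ≤ P {ω | ∀ k ≤ N,
      errorPotential f A L xt r (fun j l => ξ j l ω) lam τ ys k < 3 * R ^ 2} := by
  have hl := h.lam_pos
  have hδ := ho.bias_nonneg
  have hτ0 : 0 < τ := by linarith
  have hN0 : (0 : ℝ) < N := by exact_mod_cast hN
  -- Chosen so that `exp (-θ₀ R²) = β/N`: the moment is at most `exp (3θ₀R²)`, and Markov's
  -- inequality is applied at level `exp (4θ₀R²)`.
  set θ₀ : ℝ := Real.log (N / β) / R ^ 2 with hθ₀
  have hθ₀pos : 0 < θ₀ := by positivity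
  set d : ℕ → ℝ := fun k => stepSucc L k * (√lam * δ) with hd
  set v : ℕ → ℝ := fun k => stepSucc L k ^ 2 * (lam * σ ^ 2 / r k) with hv
  have hd0 : ∀ k, 0 ≤ d k := fun k => by
    have := stepSucc_pos h.L_pos k
    simp only [hd]; positivity
  have hv0 : ∀ k, 0 ≤ v k := fun k => by simp only [hv]; positivity
  set ρ : ℕ → ℝ := fun k => 2 * τ * (d k / R) + 4 * τ * (d k / R) ^ 2 + 64 * τ * (θ₀ * v k) +
      8 * τ * (v k / R ^ 2) with hρ
  have hρ0 : ∀ k, 0 ≤ ρ k := fun k => by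
    have := hd0 k
    have := hv0 k
    simp only [hρ]; positivity
  have hdsum : ∑ k ∈ Finset.range N, d k ≤ R / (16 * τ) := by
    rwa [← Finset.sum_mul, ← accA_eq_sum]
  have hθv : θ₀ * ∑ k ∈ Finset.range N, v k ≤ 1 / (288 * τ) := by
    rw [hθ₀, div_mul_eq_mul_div, div_le_iff₀ (by positivity)]
    refine hvar.trans (le_of_eq ?_)
    ring
  have hsmall : ∀ k < N, 128 * τ * (θ₀ * v k) ≤ 1 := fun k hk => by
    have h1 : v k ≤ ∑ k ∈ Finset.range N, v k :=
      Finset.single_le_sum (fun j _ => hv0 j) (Finset.mem_range.2 hk)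
    have h2 : θ₀ * v k ≤ 1 / (288 * τ) := le_trans (by gcongr) hθv
    have h3 := mul_le_mul_of_nonneg_left h2 (by positivity : 0 ≤ 128 * τ)
    have h4 : 128 * τ * (1 / (288 * τ)) = 128 / 288 := by field_simp
    rw [h4] at h3
    exact h3.trans (by norm_num)
  have hρsum : ∑ k ∈ Finset.range N, ρ k ≤ 1 / 2 := by
    have e : ∑ k ∈ Finset.range N, ρ k = 2 * τ * ((∑ k ∈ Finset.range N, d k) / R) +
        4 * τ * ∑ k ∈ Finset.range N, (d k / R) ^ 2 +
        64 * τ * (θ₀ * ∑ k ∈ Finset.range N, v k) +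
        8 * τ * ((∑ k ∈ Finset.range N, v k) / R ^ 2) := by
      simp only [hρ, Finset.sum_add_distrib, ← Finset.mul_sum, ← Finset.sum_div]
    have h1 : (∑ k ∈ Finset.range N, d k) / R ≤ 1 / (16 * τ) := by
      rw [div_le_iff₀ hR]; exact hdsum.trans (le_of_eq (by ring))
    have h1' : 0 ≤ (∑ k ∈ Finset.range N, d k) / R :=
      div_nonneg (Finset.sum_nonneg fun k _ => hd0 k) hR.le
    have h2 : ∑ k ∈ Finset.range N, (d k / R) ^ 2 ≤ (1 / (16 * τ)) ^ 2 := by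
      refine (Finset.sum_sq_le_sq_sum_of_nonneg fun k _ => div_nonneg (hd0 k) hR.le).trans ?_
      rw [← Finset.sum_div]
      exact pow_le_pow_left₀ h1' h1 2
    -- Since `log (N/β) ≥ 1`, one has `1/R² ≤ θ₀`, and the previous variance bound suffices.
    have h3 : (∑ k ∈ Finset.range N, v k) / R ^ 2 ≤ 1 / (288 * τ) := by
      refine le_trans ?_ hθv
      rw [hθ₀, div_mul_eq_mul_div]
      gcongr
      exact le_mul_of_one_le_left (Finset.sum_nonneg fun k _ => hv0 k) hlog
    have h4 : 4 * τ * (1 / (16 * τ)) ^ 2 ≤ 1 / 64 := by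
      have : 4 * τ * (1 / (16 * τ)) ^ 2 = 1 / 64 * (1 / τ) := by field_simp; norm_num
      rw [this]
      exact mul_le_of_le_one_right (by norm_num) (by rw [div_le_one hτ0]; exact hτ)
    rw [e]
    calc _ ≤ 2 * τ * (1 / (16 * τ)) + 4 * τ * (1 / (16 * τ)) ^ 2 + 64 * τ * (1 / (288 * τ)) +
          8 * τ * (1 / (288 * τ)) := by gcongr
      _ ≤ 1 / 8 + 1 / 64 + 64 / 288 + 8 / 288 := by
          have e1 : 2 * τ * (1 / (16 * τ)) = 1 / 8 := by field_simp; norm_num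
          have e2 : 64 * τ * (1 / (288 * τ)) = 64 / 288 := by field_simp
          have e3 : 8 * τ * (1 / (288 * τ)) = 8 / 288 := by field_simp
          linarith
      _ ≤ 1 / 2 := by norm_num
  have htail : ∀ k ≤ N, P {ω | 3 * R ^ 2 ≤
      errorPotential f A L xt r (fun j l => ξ j l ω) lam τ ys k} ≤ ENNReal.ofReal (β / N) := by
    intro k hk
    have hexp : Real.exp (∑ j ∈ Finset.range k, ρ j) ≤ 2 := by
      refine (Real.exp_le_exp.2 ?_).trans exp_half_le_two
      exact (Finset.sum_le_sum_of_subset_of_nonneg (Finset.range_mono hk)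
        fun j _ _ => hρ0 j).trans hρsum
    have h1 := lintegral_exp_errorPotential_le h ho hξ hσ hτ hr hR hys (d := d) (v := v) (ρ := ρ)
      (fun _ => rfl) (fun _ => rfl) hsmall (fun _ => rfl) hρ0 hk hθ₀pos
      (by nlinarith)
    have hm : Measurable fun ω => ENNReal.ofReal (Real.exp (θ₀ *
        (errorPotential f A L xt r (fun j l => ξ j l ω) lam τ ys k + R ^ 2))) := by
      have := measurable_errorPotential (A := A) (L := L) (r := r) (lam := lam) (τ := τ)
        (ys := ys) (k := k) h.convex ho.measurable fun j _ => hξ.measurable j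
      fun_prop
    have h2 := mul_meas_ge_le_lintegral (μ := P) hm (ENNReal.ofReal (Real.exp (θ₀ * (4 * R ^ 2))))
    have hsub : {ω | 3 * R ^ 2 ≤ errorPotential f A L xt r (fun j l => ξ j l ω) lam τ ys k} ⊆
        {ω | ENNReal.ofReal (Real.exp (θ₀ * (4 * R ^ 2))) ≤ ENNReal.ofReal (Real.exp (θ₀ *
          (errorPotential f A L xt r (fun j l => ξ j l ω) lam τ ys k + R ^ 2)))} := by
      intro ω hω
      simp only [Set.mem_ofPred_eq] at hω ⊢
      refine ENNReal.ofReal_le_ofReal (Real.exp_le_exp.2 ?_)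
      gcongr
      linarith
    have h3 : ENNReal.ofReal (Real.exp (θ₀ * (4 * R ^ 2))) * P {ω | 3 * R ^ 2 ≤
        errorPotential f A L xt r (fun j l => ξ j l ω) lam τ ys k} ≤
        ENNReal.ofReal (Real.exp (θ₀ * (3 * R ^ 2))) := by
      refine (mul_le_mul_right (measure_mono hsub) _).trans (h2.trans (h1.trans ?_))
      refine ENNReal.ofReal_le_ofReal (Real.exp_le_exp.2 ?_)
      have : θ₀ * Real.exp (∑ j ∈ Finset.range k, ρ j) * (3 / 2 * R ^ 2) ≤
        θ₀ * 2 * (3 / 2 * R ^ 2) := by gcongr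
      linarith
    have h4 : Real.exp (θ₀ * (4 * R ^ 2)) * (β / N) = Real.exp (θ₀ * (3 * R ^ 2)) := by
      have e1 : θ₀ * (4 * R ^ 2) = θ₀ * (3 * R ^ 2) + Real.log (N / β) := by
        rw [hθ₀]; field_simp; ring
      rw [e1, Real.exp_add, Real.exp_log (by positivity)]
      field_simp
    rw [← h4, ENNReal.ofReal_mul (Real.exp_pos _).le] at h3
    exact (ENNReal.mul_le_mul_iff_right (by simp [Real.exp_pos]) ENNReal.ofReal_ne_top).1 h3
  -- The bound at `k = 0` is deterministic, so only `N` bad events of probability at most `β/N`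
  -- enter the union.
  have hcover : (Set.univ : Set Ω) ⊆ {ω | ∀ k ≤ N,
      errorPotential f A L xt r (fun j l => ξ j l ω) lam τ ys k < 3 * R ^ 2} ∪
      ⋃ k ∈ Finset.Icc 1 N, {ω | 3 * R ^ 2 ≤
        errorPotential f A L xt r (fun j l => ξ j l ω) lam τ ys k} := by
    intro ω _
    by_contra hω
    simp only [Set.mem_union, Set.mem_ofPred_eq, Set.mem_iUnion, not_or, not_exists, not_le] at hω
    refine hω.1 fun k hk => ?_
    rcases Nat.eq_zero_or_pos k with rfl | hk0
    · rw [errorPotential_zero]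
      have := pow_le_pow_left₀ (norm_nonneg _) hys 2
      have := pow_pos hR 2
      linarith
    · exact hω.2 k (Finset.mem_Icc.2 ⟨hk0, hk⟩)
  have hbad : P (⋃ k ∈ Finset.Icc 1 N, {ω | 3 * R ^ 2 ≤
      errorPotential f A L xt r (fun j l => ξ j l ω) lam τ ys k}) ≤ ENNReal.ofReal β := by
    refine (measure_biUnion_finset_le _ _).trans ((Finset.sum_le_sum fun k hk =>
      htail k (Finset.mem_Icc.1 hk).2).trans (le_of_eq ?_))
    rw [Finset.sum_const, Nat.card_Icc, Nat.add_sub_cancel, ← ENNReal.ofReal_nsmul,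
      nsmul_eq_mul]
    congr 1
    field_simp
  have h1 : (1 : ENNReal) ≤ P {ω | ∀ k ≤ N,
      errorPotential f A L xt r (fun j l => ξ j l ω) lam τ ys k < 3 * R ^ 2} +
      ENNReal.ofReal β := by
    rw [← measure_univ (μ := P)]
    exact (measure_mono hcover).trans ((measure_union_le _ _).trans (by gcongr))
  rw [ENNReal.ofReal_sub _ hβ.le, ENNReal.ofReal_one]
  exact tsub_le_iff_right.2 h1

end HighProbability

/-! ### From a bounded potential to the duality gap and feasibility. -/

section Guarantee

variable {n m : ℕ} {S : Type*} {f : Vec n → ℝ} {A : Vec n →L[ℝ] Vec m} {μ lam τ L : ℝ}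
  {ys : Vec m} {xt : Vec n → S → Vec n} {r : ℕ → ℕ} {s : ℕ → ℕ → S}

theorem spdstmX_eq (N : ℕ) : spdstmX L A xt r s N =
    (accA L N)⁻¹ • ∑ k ∈ Finset.range N, stepSucc L k • pathArg f A L xt r s k +
      (accA L N)⁻¹ • errorSum f A L xt r s N := by
  rw [spdstmX, errorSum, ← smul_add, ← Finset.sum_add_distrib]
  congr 1
  refine Finset.sum_congr rfl fun k _ => ?_
  rw [← smul_add, pathError, add_sub_cancel]

theorem apply_spdstmX_eq (N : ℕ) :
    A (spdstmX L A xt r s N) = -((accA L N)⁻¹ • (pathState A L xt r s N).2) := by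
  rw [pathState, spdstmState_snd_eq_sum, smul_neg, neg_neg, spdstmX, map_smul, map_sum]
  simp only [map_smul]
  rfl

set_option maxHeartbeats 800000 in
/-- The guarantee on a sample path along which the potential stays bounded. -/
theorem spdstm_guarantee (h : IsDualSetting f A μ lam L ys) {N : ℕ} (hN : 1 ≤ N) {R Λ Lf Rf : ℝ}
    (hR : 0 < R) (hys : ‖ys‖ ≤ R) (hΛ : 0 < Λ) (hτ : τ = 1 + Λ ^ 2)
    (hpot : ∀ k ≤ N, errorPotential f A L xt r s lam τ ys k < 3 * R ^ 2)
    (hLf : Lf ≤ Λ * √lam * R)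
    (hRf : 6 * max (R / (accA L N * √lam)) (max (√lam * R / μ) ‖argDual f (tr A ys)‖) ≤ Rf)
    (hlip : ∀ x ∈ Metric.closedBall (0 : Vec n) Rf, ∀ x' ∈ Metric.closedBall (0 : Vec n) Rf,
      |f x - f x'| ≤ Lf * ‖x - x'‖) :
    f (spdstmX L A xt r s N) + dualPsi f A (spdstmY L A xt r s N) ≤ 7 * R ^ 2 / accA L N ∧
      ‖A (spdstmX L A xt r s N)‖ ≤ 7 / 2 * R / accA L N := by
  have hl := h.lam_pos
  have hsl : 0 < √lam := Real.sqrt_pos.2 hl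
  have hl2 : √lam ^ 2 = lam := Real.sq_sqrt hl.le
  have hμ := h.convex.pos
  have hA : 0 < accA L N := by
    obtain ⟨k, rfl⟩ := Nat.exists_eq_add_of_le' hN
    exact accA_succ_pos h.L_pos k
  -- Here `5/2 ≥ √6`, and below `7/4 ≥ √3`.
  have hz : ∀ k ≤ N, ‖(pathState A L xt r s k).2 - ys‖ ≤ 5 / 2 * R := fun k hk => by
    have h1 := half_sq_norm_sub_le_distBound h (xt := xt) (r := r) (s := s) k
    have h2 := hpot k hk
    have h3 : 0 ≤ τ * lam * ‖errorSum f A L xt r s k‖ ^ 2 := by rw [hτ]; positivity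
    rw [errorPotential] at h2
    refine le_of_sq_le_sq ?_ (by positivity)
    nlinarith [pow_pos hR 2]
  set E := errorSum f A L xt r s N with hE
  have hD0 : 0 ≤ distBound f A L xt r s lam ys N :=
    le_trans (by positivity) (half_sq_norm_sub_le_distBound h N)
  have hpN := hpot N le_rfl
  rw [errorPotential, ← hE] at hpN
  have hDN : distBound f A L xt r s lam ys N ≤ 3 * R ^ 2 := by
    have : 0 ≤ τ * lam * ‖E‖ ^ 2 := by rw [hτ]; positivity
    linarith
  -- The choice `τ = 1 + Λ²` bounds both `√λ‖E‖`, used for the dual side and for the distance of the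
  -- output from `xbar`, and `Λ√λ‖E‖`, used in the Lipschitz estimate.
  have hUN : lam * ‖E‖ ^ 2 + Λ ^ 2 * (lam * ‖E‖ ^ 2) ≤ 3 * R ^ 2 := by
    rw [hτ] at hpN; nlinarith
  have hU0 : 0 ≤ lam * ‖E‖ ^ 2 := by positivity
  have hE1 : √lam * ‖E‖ ≤ 7 / 4 * R := by
    refine le_of_sq_le_sq ?_ (by positivity)
    rw [mul_pow, hl2]
    nlinarith [mul_nonneg (sq_nonneg Λ) hU0, pow_pos hR 2]
  have hE2 : Λ * (√lam * ‖E‖) ≤ 7 / 4 * R := by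
    refine le_of_sq_le_sq ?_ (by positivity)
    rw [mul_pow, mul_pow, hl2]
    nlinarith [pow_pos hR 2]
  set M := max (R / (accA L N * √lam)) (max (√lam * R / μ) ‖argDual f (tr A ys)‖) with hM
  have hM1 : R / (accA L N * √lam) ≤ M := le_max_left _ _
  have hM2 : √lam * R / μ ≤ M := (le_max_left _ _).trans (le_max_right _ _)
  have hM3 : ‖argDual f (tr A ys)‖ ≤ M := (le_max_right _ _).trans (le_max_right _ _)
  have hM0 : 0 ≤ M := (norm_nonneg _).trans hM3
  have hx : ∀ k < N, ‖pathArg f A L xt r s k‖ ≤ 7 / 2 * M := fun k hk => by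
    have h1 : ‖spdstmQuery L A xt r s k - ys‖ ≤ 5 / 2 * R :=
      norm_midPoint_sub_le h.L_pos _ fun j hj => hz j (by omega)
    have h2 := h.convex.norm_argDual_sub_le (tr A (spdstmQuery L A xt r s k)) (tr A ys)
    rw [← map_sub] at h2
    have h3 := h.norm_tr_apply_le (spdstmQuery L A xt r s k - ys)
    have h4 : ‖pathArg f A L xt r s k - argDual f (tr A ys)‖ ≤ 5 / 2 * (√lam * R / μ) := by
      rw [← mul_div_assoc, le_div_iff₀ hμ]
      have h5 : √lam * ‖spdstmQuery L A xt r s k - ys‖ ≤ √lam * (5 / 2 * R) := by gcongr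
      have h6 : μ * ‖pathArg f A L xt r s k - argDual f (tr A ys)‖ ≤ _ := h2
      linarith
    have h5 := norm_le_norm_add_norm_sub' (pathArg f A L xt r s k) (argDual f (tr A ys))
    linarith
  set xbar := (accA L N)⁻¹ • ∑ k ∈ Finset.range N, stepSucc L k • pathArg f A L xt r s k with hxbar
  have hw : ∑ k ∈ Finset.range N, (accA L N)⁻¹ * stepSucc L k = 1 := by
    rw [← Finset.mul_sum, ← accA_eq_sum, inv_mul_cancel₀ hA.ne']
  have hw0 : ∀ k ∈ Finset.range N, 0 ≤ (accA L N)⁻¹ * stepSucc L k := fun k _ => by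
    have := stepSucc_pos h.L_pos k
    positivity
  have hxbar' : xbar = ∑ k ∈ Finset.range N,
      ((accA L N)⁻¹ * stepSucc L k) • pathArg f A L xt r s k := by
    simp only [hxbar, Finset.smul_sum, smul_smul]
  have hxbarM : ‖xbar‖ ≤ 7 / 2 * M := by
    rw [hxbar']
    refine (norm_sum_le _ _).trans ?_
    calc _ ≤ ∑ k ∈ Finset.range N, (accA L N)⁻¹ * stepSucc L k * (7 / 2 * M) := by
          refine Finset.sum_le_sum fun k hk => ?_
          rw [norm_smul, Real.norm_eq_abs, abs_of_nonneg (hw0 k hk)]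
          exact mul_le_mul_of_nonneg_left (hx k (Finset.mem_range.1 hk)) (hw0 k hk)
      _ = 7 / 2 * M := by rw [← Finset.sum_mul, hw, one_mul]
  have hconv : accA L N * f xbar ≤
      ∑ k ∈ Finset.range N, stepSucc L k * f (pathArg f A L xt r s k) := by
    have hc : ConvexOn ℝ Set.univ f := h.convex.strong.convexOn fun r => by positivity
    have h1 := hc.map_sum_le hw0 hw (p := fun k => pathArg f A L xt r s k)
      fun k _ => Set.mem_univ _
    rw [← hxbar'] at h1
    simp only [smul_eq_mul, mul_assoc, ← Finset.mul_sum] at h1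
    rwa [← div_eq_inv_mul, le_div_iff₀' hA] at h1
  have hdiff : spdstmX L A xt r s N - xbar = (accA L N)⁻¹ • E := by
    rw [spdstmX_eq (f := f)]; abel
  have hdiffn : ‖spdstmX L A xt r s N - xbar‖ = ‖E‖ / accA L N := by
    rw [hdiff, norm_smul, Real.norm_eq_abs, abs_of_pos (by positivity), div_eq_inv_mul]
  -- With `‖xbar‖ ≤ 7/2 M` this puts both points in the ball of radius `21/4 M ≤ 6 M`, where the
  -- Lipschitz bound holds.
  have hdiffM : ‖spdstmX L A xt r s N - xbar‖ ≤ 7 / 4 * M := by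
    have h1 : ‖E‖ / accA L N ≤ 7 / 4 * (R / (accA L N * √lam)) := by
      rw [div_le_iff₀ hA]
      have : 7 / 4 * (R / (accA L N * √lam)) * accA L N = 7 / 4 * R / √lam := by field_simp
      rw [this, le_div_iff₀ hsl]
      linarith
    rw [hdiffn]; linarith
  have hball1 : xbar ∈ Metric.closedBall (0 : Vec n) Rf := by
    rw [mem_closedBall_zero_iff]; linarith
  have hball2 : spdstmX L A xt r s N ∈ Metric.closedBall (0 : Vec n) Rf := by
    rw [mem_closedBall_zero_iff]
    have := norm_le_norm_add_norm_sub' (spdstmX L A xt r s N) xbar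
    linarith
  have hfx : f (spdstmX L A xt r s N) ≤ f xbar + 7 / 4 * R ^ 2 / accA L N := by
    have h1 := (abs_le.1 (hlip _ hball2 _ hball1)).2
    have h2 : Lf * ‖spdstmX L A xt r s N - xbar‖ ≤ Λ * √lam * R * (‖E‖ / accA L N) := by
      rw [hdiffn]; gcongr
    have h3 : Λ * √lam * R * (‖E‖ / accA L N) ≤ 7 / 4 * R ^ 2 / accA L N := by
      rw [← mul_div_assoc]
      refine div_le_div_of_nonneg_right ?_ hA.le
      have := mul_le_mul_of_nonneg_right hE2 hR.le
      linarith
    linarith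
  constructor
  · have h1 := accA_mul_dualPsi_add_sum_le h (xt := xt) (r := r) (s := s) N
    have h2 : |inner ℝ (A E) ys| ≤ 7 / 4 * R * R := by
      refine (abs_real_inner_le_norm _ _).trans ?_
      have := (h.norm_apply_le E).trans hE1
      gcongr
    have h3 := (abs_le.1 h2).1
    have h4 : accA L N * (f xbar + dualPsi f A (spdstmY L A xt r s N)) ≤ 19 / 4 * R ^ 2 := by
      change accA L N * dualPsi f A (spdstmY L A xt r s N) + _ ≤ _ at h1
      have h6 := sq_nonneg ‖ys‖
      rw [mul_add]
      linarith
    have h5 : f xbar + dualPsi f A (spdstmY L A xt r s N) ≤ 19 / 4 * R ^ 2 / accA L N := by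
      rwa [le_div_iff₀' hA]
    have h6 : 19 / 4 * R ^ 2 / accA L N + 7 / 4 * R ^ 2 / accA L N ≤ 7 * R ^ 2 / accA L N := by
      rw [← add_div]
      refine div_le_div_of_nonneg_right ?_ hA.le
      linarith [pow_pos hR 2]
    linarith
  · rw [apply_spdstmX_eq, norm_neg, norm_smul, Real.norm_eq_abs, abs_of_pos (by positivity),
      ← div_eq_inv_mul]
    gcongr
    have := norm_le_norm_add_norm_sub' (pathState A L xt r s N).2 ys
    linarith [hz N le_rfl]

end Guarantee

/-! ### Counting iterations and oracle calls. -/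

section Complexity

theorem exists_nat_div_four_sq_le {c ε : ℝ} (hε : 0 < ε) (hle : ε ≤ c) :
    ∃ N : ℕ, 1 ≤ N ∧ c / (4 * N ^ 2) ≤ ε ∧ ε ≤ c / N ^ 2 := by
  have hq : 1 ≤ c / ε := (one_le_div hε).2 hle
  have h1 : 1 ≤ √(c / ε) := Real.one_le_sqrt.2 hq
  have hsq : √(c / ε) ^ 2 = c / ε := Real.sq_sqrt (by linarith)
  -- The floor `N` of a real `t ≥ 1` satisfies `N ≤ t < 2N`, whence the factor `4`.
  have hN1 : 1 ≤ ⌊√(c / ε)⌋₊ := Nat.one_le_floor_iff _ |>.2 h1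
  have hN1' : (1 : ℝ) ≤ ⌊√(c / ε)⌋₊ := by exact_mod_cast hN1
  have hle' : (⌊√(c / ε)⌋₊ : ℝ) ≤ √(c / ε) := Nat.floor_le (by linarith)
  have hlt : √(c / ε) < ⌊√(c / ε)⌋₊ + 1 := Nat.lt_floor_add_one _
  set N := ⌊√(c / ε)⌋₊
  refine ⟨N, hN1, ?_, ?_⟩
  · rw [div_le_iff₀ (by positivity), ← div_le_iff₀' hε, ← hsq]
    nlinarith
  · rw [le_div_iff₀ (by positivity), ← le_div_iff₀' hε, ← hsq]
    gcongr

variable {n m : ℕ} {A : Vec n →L[ℝ] Vec m} {μ M R ε β H C₁ : ℝ} {N : ℕ}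

theorem lamMax_mul_sq_le (hl : 0 < lamMinPos A) (hR : 0 < R) (hRM : R ≤ M / √(lamMinPos A)) :
    lamMax A * R ^ 2 ≤ M ^ 2 * chi A := by
  have h1 := pow_le_pow_left₀ hR.le hRM 2
  rw [div_pow, Real.sq_sqrt hl.le] at h1
  have h2 := mul_le_mul_of_nonneg_left h1 (lamMax_nonneg A)
  refine h2.trans (le_of_eq ?_)
  rw [chi]; ring

theorem iterations_le (hl : 0 < lamMinPos A) (hμ : 0 < μ) (hR : 0 < R)
    (hRM : R ≤ M / √(lamMinPos A)) (hC : 0 ≤ C₁) (hHC : 2 * H ≤ C₁ ^ 2) (hε : 0 < ε)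
    (hN : 1 ≤ N) (hNε : ε ≤ H * Ltilde A μ * R ^ 2 / N ^ 2) :
    (N : ℝ) ≤ C₁ * √(M ^ 2 / (μ * ε) * chi A) := by
  have hN0 : (0 : ℝ) < N := by exact_mod_cast hN
  have h1 := lamMax_mul_sq_le hl hR hRM
  have hchi : 0 ≤ chi A := div_nonneg (lamMax_nonneg A) hl.le
  refine le_of_sq_le_sq ?_ (by positivity)
  rw [mul_pow, Real.sq_sqrt (by positivity)]
  rw [le_div_iff₀ (by positivity), Ltilde] at hNε
  have e : M ^ 2 / (μ * ε) * chi A = M ^ 2 * chi A / (μ * ε) := by ring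
  rw [e, ← mul_div_assoc, le_div_iff₀ (by positivity)]
  have h2 : H * (2 * (lamMax A / μ)) * R ^ 2 * μ = 2 * H * (lamMax A * R ^ 2) := by field_simp
  have h3 := mul_le_mul_of_nonneg_right hNε hμ.le
  have h4 : 2 * H * (lamMax A * R ^ 2) ≤ C₁ ^ 2 * (M ^ 2 * chi A) := by
    have : 0 ≤ lamMax A * R ^ 2 := mul_nonneg (lamMax_nonneg A) (sq_nonneg R)
    gcongr
  nlinarith

theorem one_le_log_div (hN : 1 ≤ N) (hβ : 0 < β) (hβ1 : β < 1 / 8) : 1 ≤ Real.log (N / β) := by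
  have hN0 : (1 : ℝ) ≤ N := by exact_mod_cast hN
  rw [Real.le_log_iff_exp_le (by positivity), le_div_iff₀ hβ]
  have := Real.exp_one_lt_d9
  nlinarith

/-- Each batch has size at most `2 + c(k+1)`. The constant part sums to at most `4N`, the linear
part to at most `3cN²`, and `N² ≤ H L̃ R²/ε` cancels `L̃` from `c`. -/
theorem oracle_calls_le (hl : 0 < lamMinPos A) (hμ : 0 < μ) (hR : 0 < R)
    (hRM : R ≤ M / √(lamMinPos A)) (hH : 0 < H) (hε : 0 < ε) (hβ : 0 < β) (hβ1 : β < 1 / 8)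
    (hN : 1 ≤ N) (hNε : ε ≤ H * Ltilde A μ * R ^ 2 / N ^ 2) {Q : ℝ} (hC : 0 ≤ C₁)
    (hQ : (N : ℝ) ≤ C₁ * Q) {σ Chat : ℝ} (hChat : 0 < Chat) :
    ∑ k ∈ Finset.range (N + 1), (⌈batchBound A μ σ ε β Chat N k⌉₊ : ℝ) ≤
      (4 * C₁ + 3 * H / (2 * Chat)) *
        max (σ ^ 2 * M ^ 2 / ε ^ 2 * chi A * Real.log (C₁ / β * Q)) Q := by
  have hN1 : (1 : ℝ) ≤ N := by exact_mod_cast hN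
  have hlam : 0 < lamMax A := hl.trans_le (lamMinPos_le_lamMax A)
  have hL : 0 < Ltilde A μ := by rw [Ltilde]; positivity
  have hlog := one_le_log_div hN hβ hβ1
  have hlog' : Real.log (N / β) ≤ Real.log (C₁ / β * Q) := by
    refine Real.log_le_log (by positivity) ?_
    rw [div_mul_eq_mul_div]
    gcongr
  set c : ℝ := lamMax A * σ ^ 2 * Real.log (N / β) / (2 * Ltilde A μ * (Chat * ε)) with hc
  have hc0 : 0 ≤ c := by positivity
  have hceil : ∀ k : ℕ, (⌈batchBound A μ σ ε β Chat N k⌉₊ : ℝ) ≤ 2 + c * (k + 1) := fun k => by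
    have e : lamMax A * σ ^ 2 * ((k + 1) / (2 * Ltilde A μ)) * Real.log (N / β) / (Chat * ε) =
        c * (k + 1) := by rw [hc]; field_simp
    have h0 : 0 ≤ c * (k + 1) := by positivity
    have h1 : batchBound A μ σ ε β Chat N k ≤ 1 + c * (k + 1) := by
      rw [batchBound, e]
      exact max_le (by linarith) (by linarith)
    have h2 : 0 ≤ batchBound A μ σ ε β Chat N k := zero_le_one.trans (le_max_left _ _)
    have := (Nat.ceil_lt_add_one h2).le
    linarith
  have hsum : ∑ k ∈ Finset.range (N + 1), ((k : ℝ) + 1) ≤ 3 * N ^ 2 := by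
    have : ∀ j : ℕ, ∑ k ∈ Finset.range j, ((k : ℝ) + 1) = j * (j + 1) / 2 := fun j => by
      induction j with
      | zero => simp
      | succ j ih => rw [Finset.sum_range_succ, ih]; push_cast; ring
    rw [this]; push_cast; nlinarith
  have hcN : c * (3 * N ^ 2) ≤ 3 * H / (2 * Chat) *
      (σ ^ 2 * M ^ 2 / ε ^ 2 * chi A * Real.log (C₁ / β * Q)) := by
    have h1 : (N : ℝ) ^ 2 ≤ H * Ltilde A μ * R ^ 2 / ε := by
      rw [le_div_iff₀ (by positivity)] at hNε
      rw [le_div_iff₀ hε]; linarith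
    calc c * (3 * N ^ 2) ≤ c * (3 * (H * Ltilde A μ * R ^ 2 / ε)) := by gcongr
      _ = 3 * H / (2 * Chat) * (σ ^ 2 / ε ^ 2 * (lamMax A * R ^ 2) * Real.log (N / β)) := by
          rw [hc]; field_simp
      _ ≤ 3 * H / (2 * Chat) * (σ ^ 2 / ε ^ 2 * (M ^ 2 * chi A) * Real.log (C₁ / β * Q)) := by
          have := lamMax_mul_sq_le hl hR hRM
          have h2 : 0 ≤ M ^ 2 * chi A := le_trans (by positivity) this
          have h3 : 0 ≤ σ ^ 2 / ε ^ 2 * (M ^ 2 * chi A) := by positivity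
          gcongr
      _ = _ := by ring
  set W := σ ^ 2 * M ^ 2 / ε ^ 2 * chi A * Real.log (C₁ / β * Q)
  calc _ ≤ ∑ k ∈ Finset.range (N + 1), (2 + c * ((k : ℝ) + 1)) :=
        Finset.sum_le_sum fun k _ => hceil k
    _ = 2 * (N + 1) + c * ∑ k ∈ Finset.range (N + 1), ((k : ℝ) + 1) := by
        rw [Finset.sum_add_distrib, ← Finset.mul_sum]; simp; ring
    _ ≤ 4 * (C₁ * Q) + 3 * H / (2 * Chat) * W := by
        have := mul_le_mul_of_nonneg_left hsum hc0
        linarith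
    _ ≤ 4 * (C₁ * max W Q) + 3 * H / (2 * Chat) * max W Q := by
        gcongr
        · exact le_max_right _ _
        · exact le_max_left _ _
    _ = _ := by ring

end Complexity

/-! ### The norm of the dual solution. -/

section DualNorm

variable {n m : ℕ} {f : Vec n → ℝ} {A : Vec n →L[ℝ] Vec m} {μ : ℝ} {xs g : Vec n} {ys : Vec m}

theorem neg_le_dualPsi (hf : IsStrongConvexWithSubgradient f μ) (hxs : A xs = 0) (y : Vec m) :
    -f xs ≤ dualPsi f A y := by
  have := hf.le_dualPhi (tr A y) xs
  rw [ContinuousLinearMap.adjoint_inner_left, hxs, inner_zero_right, zero_sub] at this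
  exact this

/-- Write `g = AᵀA v`. The subgradient inequality gives `ψ(A v) ≤ -f(x^*)`, the weak-duality lower
bound, so `A v` minimizes `ψ`; and `λ⁺_min ‖A v‖² ≤ ‖g‖²`. -/
theorem norm_le_of_isMinOn_dualPsi (hf : IsStrongConvexWithSubgradient f μ) (hxs : A xs = 0)
    (hg : IsSubgradientAt f g xs) (hker : ∀ v, A v = 0 → inner ℝ g v = 0)
    (hys : ∀ y, IsMinOn (dualPsi f A) Set.univ y → ‖ys‖ ≤ ‖y‖) :
    ‖ys‖ ≤ ‖g‖ / √(lamMinPos A) := by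
  obtain ⟨v, hv⟩ := exists_tr_apply_apply_eq A hker
  have hmin : IsMinOn (dualPsi f A) Set.univ (A v) := fun y _ => by
    refine le_trans ?_ (neg_le_dualPsi hf hxs y)
    rw [dualPsi, hv]
    refine ciSup_le fun x => ?_
    have := hg x
    rw [inner_sub_right, hker xs hxs] at this
    linarith
  refine (hys _ hmin).trans ?_
  rcases lamMinPos_pos_or A with h | rfl
  · have h1 := lamMinPos_mul_sq_norm_apply_le A v
    rw [hv] at h1
    rw [le_div_iff₀ (Real.sqrt_pos.2 h)]
    refine le_of_sq_le_sq ?_ (norm_nonneg _)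
    rw [mul_pow, Real.sq_sqrt h.le]
    linarith
  · simp only [zero_apply, norm_zero]
    positivity

end DualNorm

/-! ### Choice of constants and assembly. -/

section Main

variable {n m : ℕ} {S : Type*} [MeasurableSpace S] {f : Vec n → ℝ} {A : Vec n →L[ℝ] Vec m}
  {μ lam L δ σ R ε ell C τ : ℝ} {xt : Vec n → S → Vec n} {r : ℕ → ℕ} {N : ℕ}

/-- As `α_{k+1} ≤ (k+1)/(2L)`, the batch size makes the variance of step `k`, times `ell`, at most
`Cε α_{k+1}`; these budgets add up to `Cε A_N`. -/
theorem sum_variance_le (hL : 0 < L) (hlam : 0 < lam) (hσ : 0 < σ) (hε : 0 < ε) (hell : 0 < ell)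
    (hC : 0 < C) (hr : ∀ k < N, lam * σ ^ 2 * ((k + 1) / (2 * L)) * ell / (C * ε) ≤ r k) :
    ell * ∑ k ∈ Finset.range N, stepSucc L k ^ 2 * (lam * σ ^ 2 / r k) ≤ C * ε * accA L N := by
  rw [accA_eq_sum, Finset.mul_sum, Finset.mul_sum]
  refine Finset.sum_le_sum fun k hk => ?_
  have hα := stepSucc_pos hL k
  have h1 : lam * σ ^ 2 * stepSucc L k * ell / (C * ε) ≤ r k := by
    refine le_trans ?_ (hr k (Finset.mem_range.1 hk))
    have := (accA_bounds hL k).2.2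
    gcongr
  have h2 : 0 < lam * σ ^ 2 * stepSucc L k * ell / (C * ε) := by positivity
  have hr0 : (0 : ℝ) < r k := h2.trans_le h1
  rw [div_le_iff₀ (by positivity)] at h1
  have e : ell * (stepSucc L k ^ 2 * (lam * σ ^ 2 / r k)) =
    stepSucc L k * (lam * σ ^ 2 * stepSucc L k * ell) / r k := by ring
  rw [e, div_le_iff₀ hr0]
  have := mul_le_mul_of_nonneg_left h1 hα.le
  linarith

end Main

theorem mainTheorem2 :
    ∃ H > (0 : ℝ), ∃ K > (0 : ℝ), ∃ C₁ > (0 : ℝ), ∀ Λ > (0 : ℝ),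
    ∃ G > (0 : ℝ), ∃ Chat > (0 : ℝ), ∃ C₂ > (0 : ℝ),
    -- the problem, its primal solution `xs`, its dual solution `ys` of least norm, `M_f = ‖g‖`
    ∀ (n m : ℕ) (A : Vec n →L[ℝ] Vec m) (f : Vec n → ℝ) (μ : ℝ) (xs g : Vec n) (ys : Vec m),
      0 < μ → StrongConvexOn Set.univ μ f →
      A xs = 0 → IsMinOn f {x | A x = 0} xs →
      IsSubgradientAt f g xs → (∀ v, A v = 0 → inner ℝ g v = 0) →
      IsMinOn (dualPsi f A) Set.univ ys →
      (∀ y, IsMinOn (dualPsi f A) Set.univ y → ‖ys‖ ≤ ‖y‖) →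
      ‖ys‖ ≤ ‖g‖ / √(lamMinPos A) ∧
      ∀ Ry ε β : ℝ, 0 < Ry → ‖ys‖ ≤ Ry → Ry ≤ ‖g‖ / √(lamMinPos A) →
        0 < ε → ε ≤ H * Ltilde A μ * Ry ^ 2 → 0 < β → β < 1 / 8 →
        -- admissible numbers of iterations exist
        (∃ N : ℕ, 1 ≤ N ∧ H * Ltilde A μ * Ry ^ 2 / (4 * N ^ 2) ≤ ε ∧
          ε ≤ H * Ltilde A μ * Ry ^ 2 / N ^ 2) ∧
        ∀ N : ℕ, 1 ≤ N → H * Ltilde A μ * Ry ^ 2 / (4 * N ^ 2) ≤ ε →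
          ε ≤ H * Ltilde A μ * Ry ^ 2 / N ^ 2 →
          -- the number of iterations
          (N : ℝ) ≤ C₁ * √(‖g‖ ^ 2 / (μ * ε) * chi A) ∧
          ∀ σx : ℝ, 0 < σx →
            -- the number of oracle calls
            (∑ k ∈ Finset.range (N + 1), (⌈batchBound A μ σx ε β Chat N k⌉₊ : ℝ) ≤
              C₂ * max (σx ^ 2 * ‖g‖ ^ 2 / ε ^ 2 * chi A *
                  Real.log (C₁ / β * √(‖g‖ ^ 2 / (μ * ε) * chi A)))
                (√(‖g‖ ^ 2 / (μ * ε) * chi A))) ∧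
            -- the guarantee
            ∀ Lf Rf δy : ℝ, Lf ≤ Λ * √(lamMax A) * Ry →
              K * max (Ry / (accA (Ltilde A μ) N * √(lamMax A)))
                (max (√(lamMax A) * Ry / μ) ‖argDual f (tr A ys)‖) ≤ Rf →
              (∀ x ∈ Metric.closedBall (0 : Vec n) Rf, ∀ x' ∈ Metric.closedBall (0 : Vec n) Rf,
                |f x - f x'| ≤ Lf * ‖x - x'‖) →
              √(lamMax A) * δy ≤ G * Ltilde A μ * Ry / (N + 1) ^ 2 →
              ∀ (S : Type*) [MeasurableSpace S] (ν : Measure S) [IsProbabilityMeasure ν]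
                (xt : Vec n → S → Vec n), IsBiasedOracle f ν xt δy σx →
              ∀ (Ω : Type*) [MeasurableSpace Ω] (P : Measure Ω) [IsProbabilityMeasure P]
                (ξ : ℕ → ℕ → Ω → S),
                (∀ k l, Measurable (ξ k l)) → (∀ k l, P.map (ξ k l) = ν) →
                iIndepFun (fun p : ℕ × ℕ => ξ p.1 p.2) P →
              ∀ r : ℕ → ℕ, (∀ k < N, batchBound A μ σx ε β Chat N k ≤ r k) →
                ENNReal.ofReal (1 - 4 * β) ≤ P {ω |
                  f (spdstmX (Ltilde A μ) A xt r (fun k l => ξ k l ω) N) - f xs ≤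
                    f (spdstmX (Ltilde A μ) A xt r (fun k l => ξ k l ω) N) +
                      dualPsi f A (spdstmY (Ltilde A μ) A xt r (fun k l => ξ k l ω) N) ∧
                  f (spdstmX (Ltilde A μ) A xt r (fun k l => ξ k l ω) N) +
                      dualPsi f A (spdstmY (Ltilde A μ) A xt r (fun k l => ξ k l ω) N) ≤ ε ∧
                  ‖A (spdstmX (Ltilde A μ) A xt r (fun k l => ξ k l ω) N)‖ ≤ ε / Ry} := by

  -- `224 = 4·8·7` comes from the gap `7R²/A_N`, `A_N ≥ N²/(8L̃)` and `L̃R²/(4N²)` in the lower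
  -- bound for `ε`; `22² ≥ 2·224` serves the iteration count.
  refine ⟨224, by norm_num, 6, by norm_num, 22, by norm_num, fun Λ hΛ => ?_⟩
  obtain ⟨τ, hτ⟩ : ∃ τ : ℝ, τ = 1 + Λ ^ 2 := ⟨_, rfl⟩
  have hτ1 : 1 ≤ τ := by rw [hτ]; nlinarith [sq_nonneg Λ]
  have hτ0 : 0 < τ := by linarith
  -- With `ε ≤ 224 L̃R²/N²` and `A_N ≤ N²/(2L̃)` this makes `CεA_N` at most the variance budget
  -- `R²/(288τ)`.
  obtain ⟨C, hC⟩ : ∃ C : ℝ, C = 1 / (144 * τ * 224) := ⟨_, rfl⟩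
  have hC0 : 0 < C := by rw [hC]; positivity
  refine ⟨1 / (8 * τ), by positivity, C, hC0, 4 * 22 + 3 * 224 / (2 * C), by positivity, ?_⟩
  intro n m A f μ xs g ys hμ hf hxs _ hg hker hmin hleast
  have hfs : IsStrongConvexWithSubgradient f μ := ⟨hμ, hf, g, xs, hg⟩
  refine ⟨norm_le_of_isMinOn_dualPsi hfs hxs hg hker hleast, ?_⟩
  intro R ε β hR hysR hRM hε hεH hβ hβ1
  -- If `λ⁺_min` took its default value `0`, division by zero would make the upper bound on `R`
  -- equal to `0`.
  have hl : 0 < lamMinPos A := by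
    rcases (lamMinPos_nonneg A).eq_or_lt' with h0 | h0
    · rw [h0, Real.sqrt_zero, div_zero] at hRM
      linarith
    · exact h0
  have hlam : 0 < lamMax A := hl.trans_le (lamMinPos_le_lamMax A)
  have hset : IsDualSetting f A μ (lamMax A) (Ltilde A μ) ys :=
    ⟨hfs, hlam, norm_apply_le A, norm_tr_apply_le A, rfl, hmin⟩
  have hL := hset.L_pos
  refine ⟨exists_nat_div_four_sq_le hε hεH, ?_⟩
  intro N hN hNε1 hNε2
  have hiter := iterations_le hl hμ hR hRM (C₁ := 22) (by norm_num) (by norm_num)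
    hε hN hNε2
  refine ⟨hiter, fun σ hσ => ⟨oracle_calls_le hl hμ hR hRM (by norm_num) hε hβ hβ1 hN hNε2
    (by norm_num) hiter hC0, ?_⟩⟩
  intro Lf Rf δ hLf hRf hlip hδ S _ ν _ xt ho Ω _ P _ ξ hξm hξν hξi r hr
  have hξ : IsSampleArray P ν ξ := ⟨hξm, hξν, hξi⟩
  have hN0 : (1 : ℝ) ≤ N := by exact_mod_cast hN
  obtain ⟨hA1, hA2, -⟩ := accA_bounds hL N
  have hA0 : 0 < accA (Ltilde A μ) N := lt_of_lt_of_le (by positivity) hA1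
  have hr1 : ∀ k < N, 0 < r k := fun k hk => by
    have h1 : (1 : ℝ) ≤ r k := (le_max_left _ _).trans (hr k hk)
    exact_mod_cast zero_lt_one.trans_le h1
  have hlog := one_le_log_div hN hβ hβ1
  have hvar : Real.log (N / β) * ∑ k ∈ Finset.range N,
      stepSucc (Ltilde A μ) k ^ 2 * (lamMax A * σ ^ 2 / r k) ≤ R ^ 2 / (288 * τ) := by
    refine (sum_variance_le hL hlam hσ hε (by linarith) hC0 fun k hk =>
      (le_max_right _ _).trans (hr k hk)).trans ?_
    calc C * ε * accA (Ltilde A μ) N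
        ≤ C * (224 * Ltilde A μ * R ^ 2 / N ^ 2) * (N ^ 2 / (2 * Ltilde A μ)) := by gcongr
      _ = R ^ 2 / (288 * τ) := by rw [hC]; field_simp; norm_num
  have hbias : accA (Ltilde A μ) N * (√(lamMax A) * δ) ≤ R / (16 * τ) := by
    have hδ0 := ho.bias_nonneg
    calc accA (Ltilde A μ) N * (√(lamMax A) * δ)
        ≤ (N ^ 2 / (2 * Ltilde A μ)) * (1 / (8 * τ) * Ltilde A μ * R / (N + 1) ^ 2) := by gcongr
      _ = R / (16 * τ) * (N ^ 2 / (N + 1) ^ 2) := by field_simp; norm_num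
      _ ≤ R / (16 * τ) := mul_le_of_le_one_right (by positivity) (by
          rw [div_le_one (by positivity)]; gcongr; linarith)
  have hprob := errorPotential_lt_with_high_probability hset ho hξ hσ hτ1 hN hr1 hR hysR hβ hlog
    hbias hvar
  -- A single family of events of total probability at most `β` is excluded, which is stronger than
  -- `4β`.
  refine (ENNReal.ofReal_le_ofReal (by linarith)).trans (hprob.trans (measure_mono fun ω hω => ?_))
  obtain ⟨h1, h2⟩ := spdstm_guarantee hset hN hR hysR hΛ hτ hω hLf hRf hlip
  have hRA : 7 * R ^ 2 / accA (Ltilde A μ) N ≤ ε := by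
    refine le_trans ?_ hNε1
    rw [div_le_div_iff₀ hA0 (by positivity)]
    rw [div_le_iff₀ (by positivity)] at hA1
    have := mul_le_mul_of_nonneg_left hA1 (by positivity : 0 ≤ 28 * R ^ 2)
    linarith
  refine ⟨?_, h1.trans hRA, h2.trans ?_⟩
  · have := neg_le_dualPsi hfs hxs (spdstmY (Ltilde A μ) A xt r (fun k l => ξ k l ω) N)
    linarith
  · rw [le_div_iff₀ hR]
    refine le_trans ?_ hRA
    rw [div_mul_eq_mul_div]
    refine div_le_div_of_nonneg_right ?_ hA0.le
    nlinarith [pow_pos hR 2]
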